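/- **Theorem.** Every polycyclic group $G$ has a computable d-$\Sigma_2$ Scott sentence. Here a group is *polycyclic* if it is solvable and all of its subgroups are finitely generated. Formulas are those of $\mathcal{L}_{\omega_1,\omega}$ over the signature $\{\cdot,{}^{-1},1\}$ of groups, which allows countable conjunctions and disjunctions in addition to the first-order connectives and quantifiers. A formula is *computable* if it has a code in a fixed Gödel numbering in which all its countable conjunctions and disjunctions are, hereditarily, over computably enumerable sets of (codes of) formulas. A formula is $\Sigma_0$ or $\Pi_0$ if it is finitary and quantifier-free; for $n>0$, a $\Sigma_n$ formula is a countable disjunction of formulas $\exists \overline{x}\,\psi$ with $\overline{x}$ a finite tuple of variables and $\psi$ a $\Pi_m$ formula for some $m<n$, and a $\Pi_n$ formula is a countable conjunction of formulas $\forall \overline{x}\,\psi$ with $\psi$ a $\Sigma_m$ formula for some $m<n$. A formula is d-$\Sigma_n$ if it is a conjunction of a $\Sigma_n$ formula and a $\Pi_n$ formula. A *Scott sentence* for $G$ is a sentence whose countable models, among all structures in the signature $\{\cdot,{}^{-1},1\}$, are exactly the isomorphic copies of $G$. -/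

import Mathlib

universe u v

namespace ScottGroup

/-! ### Groups as first-order structures and polycyclic groups -/

/-- The function symbols of the signature `{·, ⁻¹, 1}` of groups. -/
inductive GroupFunc : ℕ → Type
  | one : GroupFunc 0
  | inv : GroupFunc 1
  | mul : GroupFunc 2

/-- The first-order language of groups: three function symbols and no relation symbols. -/
def groupLang : FirstOrder.Language where
  Functions := GroupFunc
  Relations := fun _ => Empty

/-- Every group is a structure for the language of groups, with the standard interpretation. -/
instance groupStructure (G : Type*) [Group G] : groupLang.Structure G where
  funMap := fun {n} (f : GroupFunc n) =>
    match n, f with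
    | _, .one => fun _ => 1
    | _, .inv => fun x => (x 0)⁻¹
    | _, .mul => fun x => x 0 * x 1
  RelMap := fun r => r.elim

/-- A group is polycyclic if it is solvable and all its subgroups are finitely generated. -/
def IsPolycyclic (G : Type*) [Group G] : Prop :=
  Group.IsSolvable G ∧ ∀ H : Subgroup G, H.FG

/-! ### Infinitary formulas -/

/-- Terms of the language of groups, in the variables `x₀, x₁, x₂, …`. -/
abbrev GTerm : Type := groupLang.Term ℕ

/-- Formulas of `L_{ω₁ω}` over the language of groups, with variables named by natural numbers.
As there are no relation symbols, the atomic formulas are the equations between terms. The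
countable conjunctions and disjunctions are families indexed by a set of natural numbers. -/
inductive InfFormula : Type
  | equal (s t : GTerm) : InfFormula
  | neg (φ : InfFormula) : InfFormula
  | and (φ ψ : InfFormula) : InfFormula
  | or (φ ψ : InfFormula) : InfFormula
  | all (x : ℕ) (φ : InfFormula) : InfFormula
  | ex (x : ℕ) (φ : InfFormula) : InfFormula
  | bigAnd (I : Set ℕ) (f : I → InfFormula) : InfFormula
  | bigOr (I : Set ℕ) (f : I → InfFormula) : InfFormula

namespace InfFormula

/-- Satisfaction of a formula in a structure `M` under the assignment `v` of the variables. -/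
def Realize {M : Type*} [groupLang.Structure M] : InfFormula → (ℕ → M) → Prop
  | equal s t, v => s.realize v = t.realize v
  | neg φ, v => ¬ φ.Realize v
  | and φ ψ, v => φ.Realize v ∧ ψ.Realize v
  | or φ ψ, v => φ.Realize v ∨ ψ.Realize v
  | all x φ, v => ∀ a : M, φ.Realize (Function.update v x a)
  | ex x φ, v => ∃ a : M, φ.Realize (Function.update v x a)
  | bigAnd _ f, v => ∀ i, (f i).Realize v
  | bigOr _ f, v => ∃ i, (f i).Realize v

/-- The set of free variables of a formula. -/
def freeVars : InfFormula → Set ℕ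
  | equal s t => ↑(s.varFinset ∪ t.varFinset)
  | neg φ => φ.freeVars
  | and φ ψ => φ.freeVars ∪ ψ.freeVars
  | or φ ψ => φ.freeVars ∪ ψ.freeVars
  | all x φ => φ.freeVars \ {x}
  | ex x φ => φ.freeVars \ {x}
  | bigAnd _ f => ⋃ i, (f i).freeVars
  | bigOr _ f => ⋃ i, (f i).freeVars

/-- A sentence is a formula without free variables. (Each subformula of a sentence then has only
finitely many free variables, since it lies in the scope of finitely many quantifiers.) -/
def IsSentence (φ : InfFormula) : Prop := φ.freeVars = ∅

/-- `M ⊨ φ`; used for sentences, whose satisfaction does not depend on the assignment. (No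
structure for the language of groups is empty, because of the constant symbol.) -/
def Holds (M : Type*) [groupLang.Structure M] (φ : InfFormula) : Prop :=
  ∀ v : ℕ → M, φ.Realize v

/-! ### The hierarchy `Σₙ`, `Πₙ`, `d-Σₙ` -/

/-- Finitary quantifier-free formulas. -/
def IsQF : InfFormula → Prop
  | equal _ _ => True
  | neg φ => φ.IsQF
  | and φ ψ => φ.IsQF ∧ ψ.IsQF
  | or φ ψ => φ.IsQF ∧ ψ.IsQF
  | all _ _ => False
  | ex _ _ => False
  | bigAnd _ _ => False
  | bigOr _ _ => False

/-- `∃ x₁ … ∃ x_k φ` for a finite tuple of variables. -/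
def exs (xs : List ℕ) (φ : InfFormula) : InfFormula := xs.foldr ex φ

/-- `∀ x₁ … ∀ x_k φ` for a finite tuple of variables. -/
def alls (xs : List ℕ) (φ : InfFormula) : InfFormula := xs.foldr all φ

mutual

/-- `Σ₀` formulas are the finitary quantifier-free ones; for `n > 0`, a `Σₙ` formula is a countable
disjunction of formulas `∃ x̄ ψ` where `ψ` is `Π_m` for some `m < n`. -/
inductive IsSigma : ℕ → InfFormula → Prop
  | zero {φ : InfFormula} (h : φ.IsQF) : IsSigma 0 φ
  | succ {n : ℕ} {I : Set ℕ} (xs : I → List ℕ) (ψ : I → InfFormula) (m : I → ℕ)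
      (hm : ∀ i, m i < n + 1) (h : ∀ i, IsPi (m i) (ψ i)) :
      IsSigma (n + 1) (bigOr I fun i => exs (xs i) (ψ i))

/-- `Π₀` formulas are the finitary quantifier-free ones; for `n > 0`, a `Πₙ` formula is a countable
conjunction of formulas `∀ x̄ ψ` where `ψ` is `Σ_m` for some `m < n`. -/
inductive IsPi : ℕ → InfFormula → Prop
  | zero {φ : InfFormula} (h : φ.IsQF) : IsPi 0 φ
  | succ {n : ℕ} {I : Set ℕ} (xs : I → List ℕ) (ψ : I → InfFormula) (m : I → ℕ)
      (hm : ∀ i, m i < n + 1) (h : ∀ i, IsSigma (m i) (ψ i)) :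
      IsPi (n + 1) (bigAnd I fun i => alls (xs i) (ψ i))

end

/-- A `d-Σₙ` formula is a conjunction of a `Σₙ` formula and a `Πₙ` formula. -/
def IsDSigma (n : ℕ) (φ : InfFormula) : Prop :=
  ∃ σ π : InfFormula, IsSigma n σ ∧ IsPi n π ∧ φ = and σ π

/-! ### Computable formulas -/

/-- Gödel numbers of terms. -/
def termCode : GTerm → ℕ
  | .var x => Nat.pair 0 x
  | .func GroupFunc.one _ => Nat.pair 1 0
  | .func GroupFunc.inv t => Nat.pair 2 (termCode (t 0))
  | .func GroupFunc.mul t => Nat.pair 3 (Nat.pair (termCode (t 0)) (termCode (t 1)))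

/-- `HasCode φ k`: the number `k` is a code (index) of the formula `φ`. A code of a countable
conjunction or disjunction is a program `c` that halts exactly on the elements of the index set
and outputs, on input `i`, a code of the `i`-th member; thus both the index set and the set of
codes of members that it enumerates are computably enumerable. Not every formula has a code. -/
inductive HasCode : InfFormula → ℕ → Prop
  | equal (s t : GTerm) :
      HasCode (equal s t) (Nat.pair 0 (Nat.pair (termCode s) (termCode t)))
  | neg {φ : InfFormula} {k : ℕ} (h : HasCode φ k) : HasCode (neg φ) (Nat.pair 1 k)
  | and {φ ψ : InfFormula} {k l : ℕ} (h₁ : HasCode φ k) (h₂ : HasCode ψ l) :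
      HasCode (and φ ψ) (Nat.pair 2 (Nat.pair k l))
  | or {φ ψ : InfFormula} {k l : ℕ} (h₁ : HasCode φ k) (h₂ : HasCode ψ l) :
      HasCode (or φ ψ) (Nat.pair 3 (Nat.pair k l))
  | all (x : ℕ) {φ : InfFormula} {k : ℕ} (h : HasCode φ k) :
      HasCode (all x φ) (Nat.pair 4 (Nat.pair x k))
  | ex (x : ℕ) {φ : InfFormula} {k : ℕ} (h : HasCode φ k) :
      HasCode (ex x φ) (Nat.pair 5 (Nat.pair x k))
  | bigAnd (c : Nat.Partrec.Code) {I : Set ℕ} (f : I → InfFormula) (g : I → ℕ)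
      (hI : ∀ i : ℕ, i ∈ I ↔ (c.eval i).Dom) (hg : ∀ i : I, g i ∈ c.eval i)
      (h : ∀ i : I, HasCode (f i) (g i)) :
      HasCode (bigAnd I f) (Nat.pair 6 (Encodable.encode c))
  | bigOr (c : Nat.Partrec.Code) {I : Set ℕ} (f : I → InfFormula) (g : I → ℕ)
      (hI : ∀ i : ℕ, i ∈ I ↔ (c.eval i).Dom) (hg : ∀ i : I, g i ∈ c.eval i)
      (h : ∀ i : I, HasCode (f i) (g i)) :
      HasCode (bigOr I f) (Nat.pair 7 (Encodable.encode c))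

/-- A formula is computable if (hereditarily) all the infinite conjunctions and disjunctions in it
are over computably enumerable sets of formulas, i.e. if it has a code. -/
def IsComputable (φ : InfFormula) : Prop := ∃ k : ℕ, HasCode φ k

/-- `φ` is a Scott sentence for the structure `A`: a sentence whose countable models are exactly
the isomorphic copies of `A`. The models range over all countable structures for the language of
groups, not only over groups. -/
def IsScottSentence (φ : InfFormula) (A : Type u) [groupLang.Structure A] : Prop :=
  φ.IsSentence ∧ ∀ (M : Type v) [groupLang.Structure M] [Countable M],
    Holds M φ ↔ Nonempty (groupLang.Equiv M A)

end InfFormula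

end ScottGroup

namespace ScottGroup

open Group

/-! ### Noetherian groups -/

-- A polycyclic group $G$ is Noetherian, hence Hopfian; it is finitely presented (P. Hall) and
-- subgroup separable, each subgroup being an intersection of subgroups of finite index (Mal'cev).
-- Fix a generating tuple $a$ with finitely many defining relations $R$. The aim is a computable
-- $\Pi_1$ condition on tuples $x$ that holds of $a$, forces $x$ to generate when $x$ lies in $G$,
-- and forces a group generated by $x$ to be $G$.
--
-- Satisfying $R$ makes $a \mapsto x$ a homomorphism, which may fail to be injective or surjective.
-- By separability either failure is visible in a finite action of $G$ with a base point. A word $w$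
-- with $w(x) = 1$ but $w(a) \ne 1$ moves the base point in some such action. If $x = u(a)$ lies in
-- a proper subgroup, some action has its base point fixed by every word of $u$ but not by all of
-- $G$. An obstruction consists of such an action, given by a finite table, with the words $u$ and
-- $w$; whether it is valid is decidable. It is realised over $x$ if some $y$ satisfies $R$, $u(y) =
-- x$ and $w(y) = 1$; an unobstructed tuple satisfies $R$ and realises no valid obstruction.
--
-- The tuple $a$ is unobstructed: if $y$ realises an obstruction over $a$, then $a \mapsto y$ is a
-- surjective endomorphism, so an automorphism, and the obstruction is invalid
-- (`Obstruction.IsValid.evalWord_ne_one`). Every unobstructed tuple of $G$ generates $G$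
-- (`IsUnobstructed.exists_evalWord_eq`), and a group generated by an unobstructed tuple is
-- isomorphic to $G$ (`IsUnobstructed.nonempty_mulEquiv`). The Scott sentence thus says that some
-- tuple is unobstructed ($\Sigma_2$), and that the group axioms hold and each unobstructed tuple
-- generates ($\Pi_2$).

theorem wellFoundedGT_subgroup {G : Type*} [Group G] (h : ∀ H : Subgroup G, H.FG) :
    WellFoundedGT (Subgroup G) := by
  rw [wellFoundedGT_iff_monotone_chain_condition]
  intro a
  obtain ⟨S, hS⟩ := h (⨆ n, a n)
  have hmem : ∀ s ∈ S, ∃ n, s ∈ a n := fun s hs => by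
    have : s ∈ ⨆ n, a n := hS ▸ Subgroup.subset_closure hs
    rwa [Subgroup.mem_iSup_of_directed a.monotone.directed_le] at this
  choose! k hk using hmem
  refine ⟨S.sup k, fun m hm => le_antisymm (a.monotone hm) ?_⟩
  refine (le_iSup a m).trans ?_
  rw [← hS, Subgroup.closure_le]
  exact fun s hs => a.monotone (Finset.le_sup hs) (hk s hs)

/-- The Hopf property: the kernels of the iterates of `f` form an ascending chain, and once it is
constant at `n`, surjectivity of the `n`-th iterate pulls any kernel element of `f` back into that
stable kernel. -/
theorem injective_of_surjective_endo {G : Type*} [Group G] [WellFoundedGT (Subgroup G)]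
    (f : G →* G) (hf : Function.Surjective f) : Function.Injective f := by
  let φ : Monoid.End G := f
  let a : ℕ →o Subgroup G :=
    { toFun := fun n => (show G →* G from φ ^ n).ker
      monotone' := monotone_nat_of_le_succ fun n x hx => by
        change (φ ^ (n + 1)) x = 1
        replace hx : (φ ^ n) x = 1 := hx
        rw [pow_succ']
        change f ((φ ^ n) x) = 1
        rw [hx, map_one] }
  obtain ⟨n, hn⟩ := WellFoundedGT.monotone_chain_condition a
  have hsurj : Function.Surjective (φ ^ n) := by
    rw [Monoid.End.coe_pow]
    exact hf.iterate n
  rw [injective_iff_map_eq_one]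
  intro x hx
  obtain ⟨y, rfl⟩ := hsurj x
  have h1 : y ∈ a (n + 1) := by
    change (φ ^ (n + 1)) y = 1
    rw [pow_succ']
    exact hx
  rw [← hn (n + 1) n.le_succ] at h1
  exact h1

namespace IsPolycyclic

theorem of_surjective {G : Type*} {Q : Type*} [Group G] [Group Q] (hG : IsPolycyclic G)
    (f : G →* Q) (hf : Function.Surjective f) : IsPolycyclic Q := by
  have := hG.1
  refine ⟨Group.isSolvable_of_surjective hf, fun H => ?_⟩
  rw [← Subgroup.map_comap_eq_self_of_surjective hf H]
  obtain ⟨S, hS⟩ := hG.2 (H.comap f)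
  classical
  exact ⟨S.image f, by rw [← hS, MonoidHom.map_closure, Finset.coe_image]⟩

theorem subgroup {G : Type*} [Group G] (hG : IsPolycyclic G) (H : Subgroup G) :
    IsPolycyclic H := by
  have := hG.1
  refine ⟨inferInstance, fun K => ?_⟩
  have h := hG.2 (K.map H.subtype)
  rw [← Group.fg_iff_subgroup_fg] at h ⊢
  exact Group.fg_of_surjective
    (f := (K.equivMapOfInjective H.subtype H.subtype_injective).symm.toMonoidHom)
    (K.equivMapOfInjective H.subtype H.subtype_injective).symm.surjective

/-- Noetherian induction over the quotients of a polycyclic group. -/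
theorem induction {P : ∀ (Q : Type u) [Group Q], Prop}
    (ih : ∀ (Q : Type u) [Group Q], IsPolycyclic Q →
      (∀ M : Subgroup Q, ∀ [M.Normal], M ≠ ⊥ → P (Q ⧸ M)) → P Q)
    {G : Type u} [Group G] (hG : IsPolycyclic G) : P G := by
  have := wellFoundedGT_subgroup hG.2
  -- The induction runs on the kernel of a surjection from `G`, so that a quotient of a quotient is
  -- handled without identifying it with a quotient of `G`.
  have key : ∀ (N : Subgroup G) (Q : Type u) [Group Q] (f : G →* Q),
      Function.Surjective f → f.ker = N → P Q := by
    intro N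
    induction N using WellFoundedGT.induction with
    | _ N hN =>
      intro Q _ f hf hker
      refine ih Q (hG.of_surjective f hf) fun M _ hM => ?_
      refine hN (M.comap f) ?_ (Q ⧸ M) ((QuotientGroup.mk' M).comp f)
        ((QuotientGroup.mk'_surjective M).comp hf) ?_
      · rw [← hker, ← MonoidHom.comap_bot]
        exact (Subgroup.comap_lt_comap_of_surjective hf).2 (bot_lt_iff_ne_bot.2 hM)
      · rw [← MonoidHom.comap_ker, QuotientGroup.ker_mk']
  exact key _ G (MonoidHom.id G) Function.surjective_id rfl

end IsPolycyclic

/-! ### Abelian normal subgroups -/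

/-- The last nontrivial term of the derived series. -/
theorem exists_normal_isMulCommutative_ne_bot {G : Type*} [Group G] [Group.IsSolvable G]
    [Nontrivial G] : ∃ A : Subgroup G, A.Normal ∧ IsMulCommutative A ∧ A ≠ ⊥ := by
  classical
  have hex := (inferInstance : Group.IsSolvable G).solvable
  have hpos : Nat.find hex ≠ 0 := fun h0 => by
    have := Nat.find_spec hex
    rw [h0, derivedSeries_zero] at this
    exact top_ne_bot this
  obtain ⟨k, hk⟩ := Nat.exists_eq_succ_of_ne_zero hpos
  refine ⟨derivedSeries G k, inferInstance, ?_, Nat.find_min hex (by omega)⟩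
  have h := Nat.find_spec hex
  rw [hk, derivedSeries_succ] at h
  exact IsMulCommutative.of_setLike_mul_comm fun a ha b hb => by
    have : a * b * a⁻¹ * b⁻¹ ∈ (⊥ : Subgroup G) := h ▸ Subgroup.commutator_mem_commutator ha hb
    exact commutatorElement_eq_one_iff_mul_comm.1 (Subgroup.mem_bot.1 this)

/-- The last infinite term `B` of the derived series has finite commutator subgroup. Being finitely
generated, it then has a centre of finite index; this centre is infinite, and normal in `G` because
it is characteristic in `B`. -/
theorem exists_normal_isMulCommutative_infinite {G : Type*} [Group G] (hG : IsPolycyclic G)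
    [Infinite G] : ∃ A : Subgroup G, A.Normal ∧ IsMulCommutative A ∧ Infinite A := by
  classical
  have hsol := hG.1
  have hex : ∃ n, Finite (derivedSeries G n) := by
    obtain ⟨n, hn⟩ := hsol.solvable
    exact ⟨n, hn ▸ inferInstance⟩
  have hpos : Nat.find hex ≠ 0 := fun h0 => by
    have := Nat.find_spec hex
    rw [h0, derivedSeries_zero] at this
    have : Finite G := Finite.of_equiv _ Subgroup.topEquiv.toEquiv
    exact not_finite G
  obtain ⟨k, hk⟩ := Nat.exists_eq_succ_of_ne_zero hpos
  have hfin := Nat.find_spec hex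
  have hinf : ¬ Finite (derivedSeries G k) := Nat.find_min hex (by omega)
  rw [hk, derivedSeries_succ] at hfin
  set B := derivedSeries G k with hB
  have hBn : B.Normal := inferInstance
  have hfg : Group.FG B := (Group.fg_iff_subgroup_fg B).2 (hG.2 B)
  have hcomm : (commutatorSet B).Finite := by
    have hsub : (Subtype.val '' commutatorSet B) ⊆ ((⁅B, B⁆ : Subgroup G) : Set G) := by
      rintro _ ⟨_, ⟨a, b, rfl⟩, rfl⟩
      exact Subgroup.commutator_mem_commutator a.2 b.2
    exact Set.Finite.of_finite_image
      ((Set.toFinite ((⁅B, B⁆ : Subgroup G) : Set G)).subset hsub) Subtype.val_injective.injOn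
  have : Finite (commutatorSet B) := hcomm
  have hfi : (Subgroup.center B).FiniteIndex := inferInstance
  have hci : Infinite (Subgroup.center B) := by
    by_contra h
    rw [not_infinite_iff_finite] at h
    exact hinf ((Subgroup.center B).finite_iff_finite_and_finiteIndex.2 ⟨h, hfi⟩)
  refine ⟨(Subgroup.center B).map B.subtype, inferInstance, inferInstance, ?_⟩
  exact Infinite.of_injective _
    ((Subgroup.center B).equivMapOfInjective B.subtype B.subtype_injective).injective

/-! ### Separability of subgroups -/

/-- Every subgroup is an intersection of subgroups of finite index. -/
def SubgroupSeparable (G : Type*) [Group G] : Prop :=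
  ∀ (H : Subgroup G) (g : G), g ∉ H → ∃ K : Subgroup G, H ≤ K ∧ K.FiniteIndex ∧ g ∉ K

/-- Krull's intersection theorem for the ideal $(p)$ of $\mathbb{Z}$: an element divisible by every
power of `p` is fixed by some multiple of `p`. A suitable prime excludes this: any prime if `x` has
infinite order, a divisor of the order otherwise. -/
theorem exists_zsmul_ne_of_ne_zero {V : Type*} [AddCommGroup V] [Module.Finite ℤ V] {x : V}
    (hx : x ≠ 0) : ∃ m : ℕ, m ≠ 0 ∧ ∀ y : V, m • y ≠ x := by
  obtain ⟨p, hp, hpx⟩ : ∃ p : ℕ, p.Prime ∧ ∀ r : ℤ, (p : ℤ) ∣ r → r • x ≠ x := by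
    rcases Nat.eq_zero_or_pos (addOrderOf x) with h0 | hpos
    · refine ⟨2, Nat.prime_two, fun r hr hrx => ?_⟩
      have : (r - 1) • x = 0 := by rw [sub_smul, hrx, one_smul, sub_self]
      rw [← addOrderOf_dvd_iff_zsmul_eq_zero, h0] at this
      simp only [Nat.cast_zero, zero_dvd_iff] at this
      push_cast at hr
      omega
    · have hne : addOrderOf x ≠ 1 := fun h => hx (AddMonoid.addOrderOf_eq_one_iff.1 h)
      obtain ⟨p, hp, hpd⟩ := Nat.exists_prime_and_dvd hne
      refine ⟨p, hp, fun r hr hrx => ?_⟩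
      have : (r - 1) • x = 0 := by rw [sub_smul, hrx, one_smul, sub_self]
      rw [← addOrderOf_dvd_iff_zsmul_eq_zero] at this
      have h1 : (p : ℤ) ∣ r - 1 := (Int.natCast_dvd_natCast.2 hpd).trans this
      have h2 : (p : ℤ) ∣ 1 := by simpa using dvd_sub hr h1
      exact hp.one_lt.ne' (by exact_mod_cast Int.eq_one_of_dvd_one (by positivity) h2)
  by_contra! hcon
  have hmem : x ∈ (⨅ i : ℕ, Ideal.span {(p : ℤ)} ^ i • ⊤ : Submodule ℤ V) := by
    rw [Submodule.mem_iInf]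
    intro i
    obtain ⟨y, hy⟩ := hcon (p ^ i) (pow_ne_zero _ hp.ne_zero)
    rw [Ideal.span_singleton_pow, Submodule.ideal_span_singleton_smul,
      Submodule.mem_smul_pointwise_iff_exists]
    refine ⟨y, trivial, ?_⟩
    rw [← hy, ← natCast_zsmul]
    push_cast
    rfl
  rw [Ideal.mem_iInf_smul_pow_eq_bot_iff] at hmem
  obtain ⟨r, hr⟩ := hmem
  exact hpx r (Ideal.mem_span_singleton.1 r.2) hr

theorem exists_mul_pow_notMem {A : Type*} [Group A] [IsMulCommutative A] [Group.FG A]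
    (B : Subgroup A) {a : A} (ha : a ∉ B) : ∃ m : ℕ, m ≠ 0 ∧ ∀ b : A, a * b ^ m ∉ B := by
  let : CommGroup A := { (inferInstance : Group A) with mul_comm := mul_comm' }
  have : Group.FG (A ⧸ B) := Group.fg_of_surjective (QuotientGroup.mk'_surjective B)
  have : Module.Finite ℤ (Additive (A ⧸ B)) := Module.Finite.iff_addGroup_fg.2 inferInstance
  have hx : Additive.ofMul (a : A ⧸ B) ≠ 0 := fun h =>
    ha ((QuotientGroup.eq_one_iff a).1 (Additive.ofMul.injective h))
  obtain ⟨m, hm, h⟩ := exists_zsmul_ne_of_ne_zero hx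
  -- If `a * b ^ m` lies in `B`, then modulo `B` the element `a` is the `m`-th power of the inverse
  -- of `b`.
  refine ⟨m, hm, fun b hb => h (Additive.ofMul ((b⁻¹ : A) : A ⧸ B)) ?_⟩
  rw [← ofMul_pow]
  congr 1
  rw [← QuotientGroup.mk_pow, QuotientGroup.eq, inv_pow, inv_inv, mul_comm]
  exact hb

/-- The subgroup of `m`-th powers of elements of an abelian subgroup. -/
def powSubgroup {G : Type*} [Group G] (A : Subgroup G) [IsMulCommutative A] (m : ℕ) :
    Subgroup G where
  carrier := {x | ∃ a ∈ A, a ^ m = x}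
  one_mem' := ⟨1, A.one_mem, one_pow m⟩
  mul_mem' := by
    rintro _ _ ⟨a, ha, rfl⟩ ⟨b, hb, rfl⟩
    exact ⟨a * b, A.mul_mem ha hb,
      (show Commute a b from setLike_mul_comm ha hb).mul_pow m⟩
  inv_mem' := by
    rintro _ ⟨a, ha, rfl⟩
    exact ⟨a⁻¹, A.inv_mem ha, inv_pow a m⟩

theorem powSubgroup_normal {G : Type*} [Group G] (A : Subgroup G) [IsMulCommutative A]
    [hA : A.Normal] (m : ℕ) : (powSubgroup A m).Normal := by
  constructor
  rintro _ ⟨a, ha, rfl⟩ g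
  exact ⟨g * a * g⁻¹, hA.conj_mem a ha g, conj_pow⟩

theorem powSubgroup_ne_bot {G : Type*} [Group G] (A : Subgroup G) [IsMulCommutative A]
    [Group.FG A] [Infinite A] {m : ℕ} (hm : m ≠ 0) : powSubgroup A m ≠ ⊥ := by
  intro h
  have htor : IsMulTorsion A := fun a => isOfFinOrder_iff_pow_eq_one.2 ⟨m, by omega, by
    have : (a : G) ^ m ∈ powSubgroup A m := ⟨a, a.2, rfl⟩
    rw [h, Subgroup.mem_bot] at this
    exact Subtype.ext this⟩
  let : CommGroup A := { (inferInstance : Group A) with mul_comm := mul_comm' }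
  have := CommGroup.finite_of_fg_isMulTorsion A htor
  exact not_finite A

/-- Mal'cev's argument. With `A` an infinite abelian normal subgroup, the quotients by the subgroups
$A^m$ are proper, so by induction `g` is separated from `H` unless $g \in H A^m$ for every $m \ne
0$. Then $g = ha$ with `a` outside `H`, and $g = h'b^m$ makes `a` an `m`-th power modulo $A \cap H$
for every `m`, which is impossible in a finitely generated abelian group. -/
theorem IsPolycyclic.subgroupSeparable {G : Type u} [Group G] (hG : IsPolycyclic G) :
    SubgroupSeparable G := by
  refine IsPolycyclic.induction (P := fun Q _ => SubgroupSeparable Q) ?_ hG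
  intro Q _ hQ ih H g hg
  rcases finite_or_infinite Q with hfin | hinf
  · exact ⟨H, le_rfl, inferInstance, hg⟩
  obtain ⟨A, hAn, hAc, hAi⟩ := exists_normal_isMulCommutative_infinite hQ
  have hAfg : Group.FG A := (Group.fg_iff_subgroup_fg A).2 (hQ.2 A)
  by_contra hcon
  have hsup : ∀ m : ℕ, m ≠ 0 → g ∈ H ⊔ powSubgroup A m := by
    intro m hm
    by_contra hgm
    have := powSubgroup_normal A m
    obtain ⟨K, hHK, hK, hgK⟩ := ih (powSubgroup A m) (powSubgroup_ne_bot A hm)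
      (H.map (QuotientGroup.mk' _)) (QuotientGroup.mk' (powSubgroup A m) g) (by
        rintro ⟨h, hh, hhg⟩
        rw [QuotientGroup.mk'_eq_mk'] at hhg
        obtain ⟨z, hz, rfl⟩ := hhg
        exact hgm (Subgroup.mul_mem_sup hh hz))
    exact hcon ⟨K.comap (QuotientGroup.mk' _), Subgroup.map_le_iff_le_comap.1 hHK,
      ⟨by
        rw [Subgroup.index_comap_of_surjective _ (QuotientGroup.mk'_surjective _)]
        exact hK.index_ne_zero⟩, hgK⟩
  have hdec : ∀ m : ℕ, m ≠ 0 → ∃ h ∈ H, ∃ a ∈ A, h * a ^ m = g := by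
    intro m hm
    have := powSubgroup_normal A m
    obtain ⟨h, hh, _, ⟨a, ha, rfl⟩, e⟩ := Subgroup.mem_sup_of_normal_right.1 (hsup m hm)
    exact ⟨h, hh, a, ha, e⟩
  obtain ⟨h, hh, a, ha, e⟩ := hdec 1 one_ne_zero
  rw [pow_one] at e
  have haH : a ∉ H := fun h' => hg (e ▸ H.mul_mem hh h')
  obtain ⟨m, hm, hpow⟩ := exists_mul_pow_notMem (H.subgroupOf A) (a := ⟨a, ha⟩)
    (by rwa [Subgroup.mem_subgroupOf])
  obtain ⟨h', hh', b, hb, e'⟩ := hdec m hm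
  refine hpow ⟨b, hb⟩⁻¹ ?_
  rw [Subgroup.mem_subgroupOf]
  have : a * (b⁻¹) ^ m = h⁻¹ * h' := by
    rw [eq_inv_mul_iff_mul_eq, ← mul_assoc, e, ← e', mul_assoc, inv_pow, mul_inv_cancel, mul_one]
  change a * (b⁻¹) ^ m ∈ H
  rw [this]
  exact H.mul_mem (H.inv_mem hh) hh'

/-! ### Finite presentability -/

/-- An extension of a finitely presented group by a finitely presented group is finitely
presented. -/
theorem isFinitelyPresented_of_extension {G : Type*} [Group G] (N : Subgroup G) [N.Normal]
    [hN : Group.IsFinitelyPresented N] [hQ : Group.IsFinitelyPresented (G ⧸ N)] :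
    Group.IsFinitelyPresented G := by
  obtain ⟨m, φ, hφ, RX, hRX, hφk⟩ := hN.out
  obtain ⟨l, ψ, hψ, RY, hRY, hψk⟩ := hQ.out
  choose y hy using fun j : Fin l => QuotientGroup.mk'_surjective N (ψ (FreeGroup.of j))
  let iX : FreeGroup (Fin m) →* FreeGroup (Fin m ⊕ Fin l) := FreeGroup.map Sum.inl
  let iY : FreeGroup (Fin l) →* FreeGroup (Fin m ⊕ Fin l) := FreeGroup.map Sum.inr
  let π : FreeGroup (Fin m ⊕ Fin l) →* G :=
    FreeGroup.lift (Sum.elim (fun i => (φ (FreeGroup.of i) : G)) y)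
  have hπX : ∀ w, π (iX w) = φ w := fun w => by
    have : π.comp iX = N.subtype.comp φ := FreeGroup.ext_hom _ _ fun i => by simp [π, iX]
    exact DFunLike.congr_fun this w
  have hπY : ∀ w, (π (iY w) : G ⧸ N) = ψ w := fun w => by
    have : (QuotientGroup.mk' N).comp (π.comp iY) = ψ :=
      FreeGroup.ext_hom _ _ fun i => by simpa [π, iY] using hy i
    exact DFunLike.congr_fun this w
  have hlift : ∀ g : FreeGroup (Fin m ⊕ Fin l), π g ∈ N → ∃ w, π (iX w) = π g := fun g hg => by
    obtain ⟨w, hw⟩ := hφ ⟨π g, hg⟩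
    exact ⟨w, by rw [hπX, hw]⟩
  have hNX : ∀ w, π (iX w) ∈ N := fun w => by rw [hπX]; exact (φ w).2
  have hconj : ∀ (j : Fin l) (i : Fin m) , ∃ w, π (iX w) =
      π (iY (FreeGroup.of j) * iX (FreeGroup.of i) * (iY (FreeGroup.of j))⁻¹) := fun j i =>
    hlift _ (by
      rw [map_mul, map_mul, map_inv]
      exact Subgroup.Normal.conj_mem inferInstance _ (hNX _) _)
  have hconj' : ∀ (j : Fin l) (i : Fin m) , ∃ w, π (iX w) =
      π ((iY (FreeGroup.of j))⁻¹ * iX (FreeGroup.of i) * iY (FreeGroup.of j)) := fun j i =>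
    hlift _ (by
      rw [map_mul, map_mul, map_inv]
      exact Subgroup.Normal.conj_mem' inferInstance _ (hNX _) _)
  have hRYN : ∀ s ∈ RY, ∃ w, π (iX w) = π (iY s) := fun s hs => hlift _ (by
    rw [← QuotientGroup.eq_one_iff, hπY, ← MonoidHom.mem_ker, ← hψk]
    exact Subgroup.subset_normalClosure hs)
  choose c hc using hconj
  choose c' hc' using hconj'
  choose! r hr using hRYN
  -- Hall's relators: those of `N`; words in the generators of `N` for their conjugates by each
  -- lifted generator and by its inverse; and such a word for each lifted relator of the quotient.
  let S : Set (FreeGroup (Fin m ⊕ Fin l)) := (iX '' RX) ∪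
    (Set.range fun p : Fin l × Fin m => (iX (c p.1 p.2))⁻¹ *
      (iY (FreeGroup.of p.1) * iX (FreeGroup.of p.2) * (iY (FreeGroup.of p.1))⁻¹)) ∪
    (Set.range fun p : Fin l × Fin m => (iX (c' p.1 p.2))⁻¹ *
      ((iY (FreeGroup.of p.1))⁻¹ * iX (FreeGroup.of p.2) * iY (FreeGroup.of p.1))) ∪
    ((fun s => (iX (r s))⁻¹ * iY s) '' RY)
  have hSfin : S.Finite := (((hRX.image _).union (Set.finite_range _)).union
    (Set.finite_range _)).union (hRY.image _)
  have hSle : Subgroup.normalClosure S ≤ π.ker := by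
    refine Subgroup.normalClosure_le_normal ?_
    rintro _ (((⟨w, hw, rfl⟩ | ⟨⟨j, i⟩, rfl⟩) | ⟨⟨j, i⟩, rfl⟩) | ⟨s, hs, rfl⟩)
    · have : φ w = 1 := by
        rw [← MonoidHom.mem_ker, ← hφk]
        exact Subgroup.subset_normalClosure hw
      simp [hπX, this]
    · simp only [SetLike.mem_coe, MonoidHom.mem_ker]
      rw [map_mul, map_inv, hc, inv_mul_cancel]
    · simp only [SetLike.mem_coe, MonoidHom.mem_ker]
      rw [map_mul, map_inv, hc', inv_mul_cancel]
    · simp only [SetLike.mem_coe, MonoidHom.mem_ker]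
      rw [map_mul, map_inv, hr s hs, inv_mul_cancel]
  let q : FreeGroup (Fin m ⊕ Fin l) →* FreeGroup (Fin m ⊕ Fin l) ⧸ Subgroup.normalClosure S :=
    QuotientGroup.mk' _
  have hq : ∀ a b : FreeGroup (Fin m ⊕ Fin l), a⁻¹ * b ∈ S → q a = q b := fun a b h =>
    QuotientGroup.eq.2 (Subgroup.subset_normalClosure h)
  let X : Subgroup (FreeGroup (Fin m ⊕ Fin l) ⧸ Subgroup.normalClosure S) := (q.comp iX).range
  have hgen : ∀ g : FreeGroup (Fin m ⊕ Fin l),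
      (∀ i : Fin m, q g * q (iX (FreeGroup.of i)) * (q g)⁻¹ ∈ X) →
      ∀ x ∈ X, q g * x * (q g)⁻¹ ∈ X := by
    rintro g hg _ ⟨w, rfl⟩
    change q g * q (iX w) * (q g)⁻¹ ∈ X
    induction w using FreeGroup.induction_on with
    | C1 => simp [X.one_mem]
    | of i => exact hg i
    | inv_of i h =>
      have := X.inv_mem h
      simpa [mul_assoc] using this
    | mul a b ha hb =>
      have := X.mul_mem ha hb
      simpa [mul_assoc] using this
  have hiX : ∀ i, iX (FreeGroup.of i) = FreeGroup.of (Sum.inl i) := fun i => by simp [iX]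
  have hiY : ∀ j, iY (FreeGroup.of j) = FreeGroup.of (Sum.inr j) := fun j => by simp [iY]
  -- Conjugation by a lifted generator and by its inverse both have to preserve `X`, which is why
  -- `S` holds both families of conjugation relators.
  have hXn : X.Normal := by
    constructor
    intro x hx p
    obtain ⟨g, rfl⟩ := QuotientGroup.mk'_surjective _ p
    change q g * x * (q g)⁻¹ ∈ X
    have hXmem : ∀ w, q (iX w) ∈ X := fun w => ⟨w, rfl⟩
    induction g using FreeGroup.induction_on generalizing x with
    | C1 => simpa using hx
    | of t =>
      rcases t with i | j
      · rw [← hiX i]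
        exact X.mul_mem (X.mul_mem (hXmem _) hx) (X.inv_mem (hXmem _))
      · refine hgen _ (fun i => ?_) x hx
        rw [← hiY j, ← map_inv, ← map_mul, ← map_mul,
          ← hq (iX (c j i)) _ (Or.inl (Or.inl (Or.inr ⟨(j, i), rfl⟩)))]
        exact hXmem _
    | inv_of t _ =>
      rcases t with i | j
      · rw [← hiX i, map_inv]
        exact X.mul_mem (X.mul_mem (X.inv_mem (hXmem _)) hx) (X.inv_mem (X.inv_mem (hXmem _)))
      · refine hgen _ (fun i => ?_) x hx
        rw [← hiY j, map_inv q, inv_inv, ← map_inv q, ← map_mul, ← map_mul,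
          ← hq (iX (c' j i)) _ (Or.inl (Or.inr ⟨(j, i), rfl⟩))]
        exact hXmem _
    | mul a b ha hb =>
      have := ha _ (hb _ hx)
      simpa [mul_assoc] using this
  let p : FreeGroup (Fin m ⊕ Fin l) →* FreeGroup (Fin l) :=
    FreeGroup.lift (Sum.elim (fun _ => 1) FreeGroup.of)
  let t : FreeGroup (Fin l) →* (FreeGroup (Fin m ⊕ Fin l) ⧸ Subgroup.normalClosure S) ⧸ X :=
    (QuotientGroup.mk' X).comp (q.comp iY)
  have htp : ∀ g, t (p g) = QuotientGroup.mk' X (q g) := fun g => by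
    have : t.comp p = (QuotientGroup.mk' X).comp q := FreeGroup.ext_hom _ _ fun
      | .inl i => by
        have : QuotientGroup.mk' X (q (FreeGroup.of (Sum.inl i))) = 1 :=
          (QuotientGroup.eq_one_iff _).2 ⟨FreeGroup.of i, by simp [iX]⟩
        simpa [p] using this.symm
      | .inr j => by simp [p, t, iY]
    exact DFunLike.congr_fun this g
  have hψp : ∀ g, ψ (p g) = (π g : G ⧸ N) := fun g => by
    have : ψ.comp p = (QuotientGroup.mk' N).comp π := FreeGroup.ext_hom _ _ fun
      | .inl i => by
        have : ((φ (FreeGroup.of i) : G) : G ⧸ N) = 1 :=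
          (QuotientGroup.eq_one_iff _).2 (φ (FreeGroup.of i)).2
        simpa [p, π] using this.symm
      | .inr j => by simpa [p, π] using (hy j).symm
    exact DFunLike.congr_fun this g
  -- An element of the kernel dies in the quotient of `G`, so modulo `S` it is a word in the
  -- generators of `N`; that word is trivial in `N`, hence a consequence of the relators of `N`.
  have hker : π.ker ≤ Subgroup.normalClosure S := by
    intro g hg
    have h1 : p g ∈ Subgroup.normalClosure RY := by
      rw [hψk, MonoidHom.mem_ker, hψp, MonoidHom.mem_ker.1 hg]
      rfl
    have h2 : Subgroup.normalClosure RY ≤ t.ker := Subgroup.normalClosure_le_normal fun s hs => by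
      refine MonoidHom.mem_ker.2 ((QuotientGroup.eq_one_iff _).2 ⟨r s, ?_⟩)
      exact hq _ _ (Or.inr ⟨s, hs, rfl⟩)
    have h3 : q g ∈ X := by
      rw [← QuotientGroup.eq_one_iff]
      exact (htp g).symm.trans (h2 h1)
    obtain ⟨w, hw⟩ := h3
    have h4 : (iX w)⁻¹ * g ∈ Subgroup.normalClosure S := QuotientGroup.eq.1 hw
    have h5 : φ w = 1 := by
      have := hSle h4
      rw [MonoidHom.mem_ker, map_mul, MonoidHom.mem_ker.1 hg, mul_one, map_inv, inv_eq_one,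
        hπX] at this
      exact Subtype.ext this
    have h6 : Subgroup.normalClosure RX ≤ (Subgroup.normalClosure S).comap iX :=
      Subgroup.normalClosure_le_normal fun s hs =>
        Subgroup.subset_normalClosure (Or.inl (Or.inl (Or.inl ⟨s, hs, rfl⟩)))
    have h7 : iX w ∈ Subgroup.normalClosure S := h6 (hφk ▸ MonoidHom.mem_ker.2 h5)
    simpa using mul_mem h7 h4
  have hπsurj : Function.Surjective π := by
    intro g
    obtain ⟨w, hw⟩ := hψ g
    have : (π (iY w))⁻¹ * g ∈ N := QuotientGroup.eq.1 ((hπY w).trans hw)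
    obtain ⟨x, hx⟩ := hφ ⟨_, this⟩
    exact ⟨iY w * iX x, by rw [map_mul, hπX, hx, mul_inv_cancel_left]⟩
  have : Group.IsFinitelyPresented (FreeGroup (Fin m ⊕ Fin l)) := inferInstance
  exact this.of_surjective π hπsurj ⟨S, hSfin, le_antisymm hSle hker⟩

theorem isFinitelyPresented_zpowers {G : Type*} [Group G] (a : G) :
    Group.IsFinitelyPresented (Subgroup.zpowers a) := by
  let f : Multiplicative ℤ →* Subgroup.zpowers a :=
    zpowersHom _ ⟨a, Subgroup.mem_zpowers a⟩
  refine Group.IsFinitelyPresented.of_surjective f ?_ ?_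
  · rintro ⟨_, k, rfl⟩
    exact ⟨Multiplicative.ofAdd k, Subtype.ext (by simp [f])⟩
  · have : Group.FG f.ker := by
      rw [Group.fg_iff_subgroup_fg, Subgroup.fg_iff_add_fg]
      have := (Submodule.fg_iff_addSubgroup_fg _).1
        (IsNoetherian.noetherian (AddSubgroup.toIntSubmodule f.ker.toAddSubgroup))
      exact this
    exact .of_FG _

theorem IsPolycyclic.isFinitelyPresented_of_comm {G : Type u} [Group G] (hG : IsPolycyclic G)
    (hc : ∀ a b : G, a * b = b * a) : Group.IsFinitelyPresented G := by
  refine IsPolycyclic.induction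
    (P := fun Q _ => (∀ a b : Q, a * b = b * a) → Group.IsFinitelyPresented Q) ?_ hG hc
  intro Q _ _ ih hcomm
  rcases subsingleton_or_nontrivial Q with _ | _
  · infer_instance
  obtain ⟨a, ha⟩ := exists_ne (1 : Q)
  have hn : (Subgroup.zpowers a).Normal := ⟨fun x hx g => by
    rwa [hcomm g x, mul_inv_cancel_right]⟩
  have := isFinitelyPresented_zpowers a
  have := ih (Subgroup.zpowers a) (by simpa using ha) (by
    intro x y
    obtain ⟨x, rfl⟩ := QuotientGroup.mk_surjective x
    obtain ⟨y, rfl⟩ := QuotientGroup.mk_surjective y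
    rw [← QuotientGroup.mk_mul, hcomm, QuotientGroup.mk_mul])
  exact isFinitelyPresented_of_extension (Subgroup.zpowers a)

/-- Noetherian induction: `A` is abelian, hence finitely presented as an iterated extension of
cyclic groups, and the quotient by `A` is covered by the induction. -/
theorem IsPolycyclic.isFinitelyPresented {G : Type u} [Group G] (hG : IsPolycyclic G) :
    Group.IsFinitelyPresented G := by
  refine IsPolycyclic.induction (P := fun Q _ => Group.IsFinitelyPresented Q) ?_ hG
  intro Q _ hQ ih
  rcases subsingleton_or_nontrivial Q with _ | _
  · infer_instance
  have := hQ.1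
  obtain ⟨A, hA, hAc, hA1⟩ := exists_normal_isMulCommutative_ne_bot (G := Q)
  have := (hQ.subgroup A).isFinitelyPresented_of_comm mul_comm'
  have := ih A hA1
  exact isFinitelyPresented_of_extension A

-- Presentations by positive words

/-- The value of a word, a list of letters read modulo `n`, at a tuple of `n` elements. -/
def evalWord {G : Type*} [Monoid G] {n : ℕ} [NeZero n] (a : Fin n → G) (w : List ℕ) : G :=
  (w.map fun l => a (Fin.ofNat n l)).prod

section evalWord

variable {G H : Type*} {n : ℕ} [NeZero n]

@[simp]
theorem evalWord_nil [Monoid G] (a : Fin n → G) : evalWord a [] = 1 := rfl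

@[simp]
theorem evalWord_cons [Monoid G] (a : Fin n → G) (l : ℕ) (w : List ℕ) :
    evalWord a (l :: w) = a (Fin.ofNat n l) * evalWord a w := by
  simp [evalWord]

theorem evalWord_append [Monoid G] (a : Fin n → G) (w w' : List ℕ) :
    evalWord a (w ++ w') = evalWord a w * evalWord a w' := by
  simp [evalWord]

theorem evalWord_singleton [Monoid G] (a : Fin n → G) (i : Fin n) :
    evalWord a [(i : ℕ)] = a i := by
  simp

theorem map_evalWord [Monoid G] [Monoid H] (f : G →* H) (a : Fin n → G) (w : List ℕ) :
    f (evalWord a w) = evalWord (fun i => f (a i)) w := by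
  induction w with
  | nil => simp
  | cons l w ih => simp [ih]

theorem evalWord_mem [Group G] (a : Fin n → G) {K : Subgroup G} (h : ∀ i, a i ∈ K)
    (w : List ℕ) : evalWord a w ∈ K := by
  induction w with
  | nil => exact K.one_mem
  | cons l w ih => rw [evalWord_cons]; exact K.mul_mem (h _) ih

end evalWord

/-- `a` is a tuple generating `G` as a monoid, and the group `G` is presented by the relations
`r = 1` between the members of `a`, for the words `r` in the finite list `R`. The list contains
relations that make a product of letters an inverse of each letter. -/
structure IsPresentedBy {G : Type*} [Group G] {n : ℕ} [NeZero n] (a : Fin n → G)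
    (R : List (List ℕ)) : Prop where
  exists_evalWord_eq : ∀ g, ∃ w, evalWord a w = g
  exists_inverse : ∀ i : Fin n, ∃ v, (i : ℕ) :: v ∈ R ∧ v ++ [(i : ℕ)] ∈ R
  ker_lift : (FreeGroup.lift a).ker =
    Subgroup.normalClosure {x | ∃ r ∈ R, evalWord FreeGroup.of r = x}

namespace IsPresentedBy

variable {G H : Type*} [Group G] [Group H] {n : ℕ} [NeZero n] {a : Fin n → G} {R : List (List ℕ)}

theorem evalWord_eq_one (h : IsPresentedBy a R) {r : List ℕ} (hr : r ∈ R) :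
    evalWord a r = 1 := by
  have : evalWord FreeGroup.of r ∈ (FreeGroup.lift a).ker := by
    rw [h.ker_lift]
    exact Subgroup.subset_normalClosure ⟨r, hr, rfl⟩
  rw [MonoidHom.mem_ker, map_evalWord] at this
  simpa using this

/-- Von Dyck's theorem. -/
theorem exists_hom (h : IsPresentedBy a R) {b : Fin n → H} (hb : ∀ r ∈ R, evalWord b r = 1) :
    ∃ f : G →* H, ∀ i, f (a i) = b i := by
  have hsurj : Function.Surjective (FreeGroup.lift a) := fun g => by
    obtain ⟨w, rfl⟩ := h.exists_evalWord_eq g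
    exact ⟨evalWord FreeGroup.of w, by simp [map_evalWord]⟩
  have hle : (FreeGroup.lift a).ker ≤ (FreeGroup.lift b).ker := by
    rw [h.ker_lift]
    refine Subgroup.normalClosure_le_normal ?_
    rintro _ ⟨r, hr, rfl⟩
    rw [SetLike.mem_coe, MonoidHom.mem_ker, map_evalWord]
    simpa using hb r hr
  refine ⟨(FreeGroup.lift a).liftOfSurjective hsurj ⟨FreeGroup.lift b, hle⟩, fun i => ?_⟩
  have := (FreeGroup.lift a).liftOfRightInverse_comp_apply _ (Function.rightInverse_surjInv hsurj)
    ⟨FreeGroup.lift b, hle⟩ (FreeGroup.of i)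
  simpa using this

end IsPresentedBy

/-- The kernel of a surjection from a free group of finite rank to a finitely presented group is
the normal closure of a finite set. -/
theorem isFinitelyNormallyGenerated_ker {G : Type*} [Group G] [hG : Group.IsFinitelyPresented G]
    {n : ℕ} (ψ : FreeGroup (Fin n) →* G) (hψ : Function.Surjective ψ) :
    ψ.ker.IsFinitelyNormallyGenerated := by
  obtain ⟨m, φ, hφ, S, hS, hφk⟩ := hG.out
  choose s hs using fun i => hφ (ψ (FreeGroup.of i))
  choose t ht using fun j => hψ (φ (FreeGroup.of j))
  have hσ : ∀ x, φ (FreeGroup.lift s x) = ψ x := fun x => by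
    have : φ.comp (FreeGroup.lift s) = ψ := FreeGroup.ext_hom _ _ fun i => by simp [hs]
    exact DFunLike.congr_fun this x
  have hτ : ∀ x, ψ (FreeGroup.lift t x) = φ x := fun x => by
    have : ψ.comp (FreeGroup.lift t) = φ := FreeGroup.ext_hom _ _ fun i => by simp [ht]
    exact DFunLike.congr_fun this x
  -- The old relators rewritten in the new generators, together with relators saying that rewriting
  -- a new generator back and forth returns it.
  let T : Set (FreeGroup (Fin n)) := (FreeGroup.lift t '' S) ∪
    Set.range fun i => (FreeGroup.lift t (FreeGroup.lift s (FreeGroup.of i)))⁻¹ * FreeGroup.of i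
  refine ⟨T, (hS.image _).union (Set.finite_range _), le_antisymm ?_ fun g hg => ?_⟩
  · refine Subgroup.normalClosure_le_normal ?_
    rintro _ (⟨x, hx, rfl⟩ | ⟨i, rfl⟩)
    · rw [SetLike.mem_coe, MonoidHom.mem_ker, hτ, ← MonoidHom.mem_ker, ← hφk]
      exact Subgroup.subset_normalClosure hx
    · rw [SetLike.mem_coe, MonoidHom.mem_ker, map_mul, map_inv, hτ, hσ, inv_mul_cancel]
  · let q := QuotientGroup.mk' (Subgroup.normalClosure T)
    have h1 : q (FreeGroup.lift t (FreeGroup.lift s g)) = q g := by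
      have : (q.comp (FreeGroup.lift t)).comp (FreeGroup.lift s) = q :=
        FreeGroup.ext_hom _ _ fun i =>
          QuotientGroup.eq.2 (Subgroup.subset_normalClosure (Or.inr ⟨i, rfl⟩))
      exact DFunLike.congr_fun this g
    have h2 : FreeGroup.lift s g ∈ Subgroup.normalClosure S := by
      rw [hφk, MonoidHom.mem_ker, hσ, MonoidHom.mem_ker.1 hg]
    have h3 : Subgroup.normalClosure S ≤ (q.comp (FreeGroup.lift t)).ker :=
      Subgroup.normalClosure_le_normal fun x hx => (QuotientGroup.eq_one_iff _).2
        (Subgroup.subset_normalClosure (Or.inl ⟨x, hx, rfl⟩))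
    rw [← QuotientGroup.eq_one_iff]
    exact h1.symm.trans (h3 h2)

theorem exists_isPresentedBy {G : Type*} [Group G] [Group.IsFinitelyPresented G] :
    ∃ (n : ℕ) (_ : NeZero n) (a : Fin n → G) (R : List (List ℕ)), IsPresentedBy a R := by
  classical
  have hfg : Group.FG G := by
    obtain ⟨m, φ, hφ, -⟩ := (inferInstance : Group.IsFinitelyPresented G).out
    exact Group.fg_of_surjective hφ
  obtain ⟨S, hS⟩ := Monoid.fg_def.1 (Monoid.fg_of_group_fg (G := G))
  -- The extra generator `1` keeps the tuple nonempty, so that letters can be read modulo its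
  -- length.
  let L : List G := 1 :: S.toList
  have : NeZero L.length := ⟨by simp [L]⟩
  let a : Fin L.length → G := L.get
  have hex : ∀ g, ∃ w, evalWord a w = g := by
    intro g
    have hg : g ∈ Submonoid.closure (S : Set G) := hS ▸ Submonoid.mem_top g
    induction hg using Submonoid.closure_induction with
    | mem x hx =>
      have : x ∈ L := by simp [L, Finset.mem_coe.1 hx]
      obtain ⟨i, hi⟩ := List.mem_iff_get.1 this
      exact ⟨[(i : ℕ)], by rw [evalWord_singleton]; exact hi⟩
    | one => exact ⟨[], rfl⟩
    | mul x y _ _ hx hy =>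
      obtain ⟨w, rfl⟩ := hx
      obtain ⟨w', rfl⟩ := hy
      exact ⟨w ++ w', evalWord_append a w w'⟩
  have hsurj : Function.Surjective (FreeGroup.lift a) := fun g => by
    obtain ⟨w, rfl⟩ := hex g
    exact ⟨evalWord FreeGroup.of w, by simp [map_evalWord]⟩
  obtain ⟨T, hT, hTk⟩ := isFinitelyNormallyGenerated_ker (FreeGroup.lift a) hsurj
  choose v hv using fun i => hex (a i)⁻¹
  let R₁ : List (List ℕ) := List.ofFn fun i : Fin L.length => (i : ℕ) :: v i
  let R₂ : List (List ℕ) := List.ofFn fun i : Fin L.length => v i ++ [(i : ℕ)]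
  let N := Subgroup.normalClosure
    {x : FreeGroup (Fin L.length) | ∃ r ∈ R₁, evalWord FreeGroup.of r = x}
  let q := QuotientGroup.mk' N
  have hinv : ∀ i, q (FreeGroup.of i)⁻¹ = q (evalWord FreeGroup.of (v i)) := fun i => by
    refine QuotientGroup.eq.2 (Subgroup.subset_normalClosure ⟨(i : ℕ) :: v i, ?_, ?_⟩)
    · exact List.mem_ofFn.2 ⟨i, rfl⟩
    · simp
  -- Modulo the inverse relations `R₁`, every element of the free group is a positive word, so the
  -- relators can be replaced by positive ones.
  have hpos : ∀ x, ∃ w, q x = q (evalWord FreeGroup.of w) := by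
    intro x
    induction x using FreeGroup.induction_on with
    | C1 => exact ⟨[], rfl⟩
    | of i => exact ⟨[(i : ℕ)], by rw [evalWord_singleton]⟩
    | inv_of i _ => exact ⟨v i, hinv i⟩
    | mul x y hx hy =>
      obtain ⟨w, hw⟩ := hx
      obtain ⟨w', hw'⟩ := hy
      exact ⟨w ++ w', by rw [map_mul, hw, hw', ← map_mul, ← evalWord_append]⟩
  choose p hp using hpos
  let R := R₁ ++ (R₂ ++ hT.toFinset.toList.map p)
  refine ⟨L.length, inferInstance, a, R, hex, fun i => ⟨v i,
    List.mem_append_left _ (List.mem_ofFn.2 ⟨i, rfl⟩),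
    List.mem_append_right _ (List.mem_append_left _ (List.mem_ofFn.2 ⟨i, rfl⟩))⟩,
    le_antisymm ?_ ?_⟩
  · have hN : N ≤ Subgroup.normalClosure
        {x : FreeGroup (Fin L.length) | ∃ r ∈ R, evalWord FreeGroup.of r = x} :=
      Subgroup.normalClosure_mono fun x ⟨r, hr, hx⟩ => ⟨r, List.mem_append_left _ hr, hx⟩
    rw [← hTk]
    refine Subgroup.normalClosure_le_normal fun t ht => ?_
    have h1 : (evalWord (n := L.length) FreeGroup.of (p t))⁻¹ * t ∈ N :=
      QuotientGroup.eq.1 (hp t).symm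
    have h2 : evalWord FreeGroup.of (p t) ∈ Subgroup.normalClosure
        {x : FreeGroup (Fin L.length) | ∃ r ∈ R, evalWord FreeGroup.of r = x} :=
      Subgroup.subset_normalClosure ⟨p t, List.mem_append_right _ (List.mem_append_right _
        (List.mem_map.2 ⟨t, by simpa using ht, rfl⟩)), rfl⟩
    simpa using mul_mem h2 (hN h1)
  · have hN : N ≤ (FreeGroup.lift a).ker := by
      refine Subgroup.normalClosure_le_normal ?_
      rintro _ ⟨r, hr, rfl⟩
      obtain ⟨i, rfl⟩ := List.mem_ofFn.1 hr
      rw [SetLike.mem_coe, MonoidHom.mem_ker, map_evalWord]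
      simp [hv]
    refine Subgroup.normalClosure_le_normal ?_
    rintro _ ⟨r, hr, rfl⟩
    rcases List.mem_append.1 hr with hr | hr
    · exact hN (Subgroup.subset_normalClosure ⟨r, hr, rfl⟩)
    rcases List.mem_append.1 hr with hr | hr
    · obtain ⟨i, rfl⟩ := List.mem_ofFn.1 hr
      rw [SetLike.mem_coe, MonoidHom.mem_ker, map_evalWord]
      simp [evalWord_append, hv]
    · obtain ⟨t, ht, rfl⟩ := List.mem_map.1 hr
      have ht' : t ∈ (FreeGroup.lift a).ker := by
        rw [← hTk]
        exact Subgroup.subset_normalClosure (by simpa using ht)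
      have h1 : t⁻¹ * evalWord FreeGroup.of (p t) ∈ N := QuotientGroup.eq.1 (hp t)
      simpa using mul_mem ht' (hN h1)

/-! ### Tables of permutations -/

/-- The map of `ℕ` described by row `l` of a table; it is the identity outside the row. -/
def tableMap (T : List (List ℕ)) (l x : ℕ) : ℕ := (T.getD l [])[x]?.getD x

/-- The action on `ℕ` of a word, its letters being read modulo `n` as rows of a table. -/
def runWord (n : ℕ) (T : List (List ℕ)) (w : List ℕ) (x : ℕ) : ℕ :=
  w.foldr (fun l y => tableMap T (l % n) y) x

/-- The rows of the table have length at most `d`, and the relations in `R` hold in it. -/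
def IsTable (n : ℕ) (R : List (List ℕ)) (d : ℕ) (T : List (List ℕ)) : Prop :=
  (∀ l < n, (T.getD l []).length ≤ d) ∧ ∀ x < d, ∀ r ∈ R, runWord n T r x = x

/-- The data of an obstruction: a bound and a table, a tuple of words, and a word. -/
abbrev Obstruction : Type := (ℕ × List (List ℕ)) × List (List ℕ) × List ℕ

/-- The table of the obstruction satisfies the relations in `R`, and in the corresponding action
either the word moves `0`, or the tuple of words fixes `0` but some letter moves it. -/
def Obstruction.IsValid (n : ℕ) (R : List (List ℕ)) (D : Obstruction) : Prop :=
  IsTable n R D.1.1 D.1.2 ∧ (runWord n D.1.2 D.2.2 0 ≠ 0 ∨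
    ((∀ k < n, runWord n D.1.2 (D.2.1.getD k []) 0 = 0) ∧ ∃ k < n, tableMap D.1.2 k 0 ≠ 0))

theorem runWord_append (n : ℕ) (T : List (List ℕ)) (w w' : List ℕ) (x : ℕ) :
    runWord n T (w ++ w') x = runWord n T w (runWord n T w' x) := by
  simp [runWord]

theorem runWord_cons (n : ℕ) (T : List (List ℕ)) (l : ℕ) (w : List ℕ) (x : ℕ) :
    runWord n T (l :: w) x = tableMap T (l % n) (runWord n T w x) := rfl

/-- Hence the bounded check in `IsTable` yields the relations on all of `ℕ`. -/
theorem IsTable.runWord_of_le {n : ℕ} [NeZero n] {R : List (List ℕ)} {d : ℕ} {T : List (List ℕ)}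
    (hT : IsTable n R d T) (w : List ℕ) {x : ℕ} (hx : d ≤ x) : runWord n T w x = x := by
  induction w with
  | nil => rfl
  | cons l w ih =>
    rw [runWord_cons, ih, tableMap, List.getElem?_eq_none, Option.getD_none]
    exact (hT.1 _ (Nat.mod_lt _ (Nat.pos_of_neZero n))).trans hx

section

variable {G : Type*} [Group G] {n : ℕ} [NeZero n] {a : Fin n → G} {R : List (List ℕ)}

theorem IsTable.exists_hom (h : IsPresentedBy a R) {d : ℕ} {T : List (List ℕ)}
    (hT : IsTable n R d T) :
    ∃ ρ : G →* Equiv.Perm ℕ, ∀ w x, ρ (evalWord a w) x = runWord n T w x := by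
  have hR : ∀ r ∈ R, ∀ x, runWord n T r x = x := fun r hr x => by
    rcases lt_or_ge x d with hx | hx
    · exact hT.2 x hx r hr
    · exact hT.runWord_of_le r hx
  -- The inverse relations make each row a permutation of `ℕ`, with inverse the action of `v i`.
  choose v hv hv' using h.exists_inverse
  let b : Fin n → Equiv.Perm ℕ := fun i =>
    { toFun := tableMap T i
      invFun := runWord n T (v i)
      left_inv := fun x => by
        have := hR _ (hv' i) x
        rwa [runWord_append, runWord_cons, Nat.mod_eq_of_lt i.2] at this
      right_inv := fun x => by
        have := hR _ (hv i) x
        rwa [runWord_cons, Nat.mod_eq_of_lt i.2] at this }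
  have hb : ∀ w x, evalWord b w x = runWord n T w x := fun w x => by
    induction w with
    | nil => rfl
    | cons l w ih =>
      rw [evalWord_cons, Equiv.Perm.mul_apply, ih, runWord_cons]
      rfl
  obtain ⟨ρ, hρ⟩ := h.exists_hom (b := b) fun r hr => Equiv.ext fun x => (hb r x).trans (hR r hr x)
  refine ⟨ρ, fun w x => ?_⟩
  rw [map_evalWord, ← hb]
  simp only [hρ]

/-- A valid obstruction cannot be realised by a tuple in `G` that satisfies the relations and
from which the tuple `a` can be recovered by the words of the obstruction. -/
theorem Obstruction.IsValid.evalWord_ne_one [WellFoundedGT (Subgroup G)] (h : IsPresentedBy a R)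
    {D : Obstruction} (hD : D.IsValid n R) {b : Fin n → G} (hb : ∀ r ∈ R, evalWord b r = 1)
    (hba : ∀ k : Fin n, evalWord b (D.2.1.getD k []) = a k) : evalWord b D.2.2 ≠ 1 := by
  obtain ⟨f, hf⟩ := h.exists_hom hb
  have hfe : ∀ w, f (evalWord a w) = evalWord b w := fun w => by
    rw [map_evalWord]; simp only [hf]
  have hfa : ∀ k : Fin n, f (evalWord a (D.2.1.getD k [])) = a k := fun k => by rw [hfe, hba]
  have hsurj : Function.Surjective f := fun g => by
    obtain ⟨w, rfl⟩ := h.exists_evalWord_eq g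
    exact evalWord_mem (K := f.range) a (fun i => ⟨_, hfa i⟩) w
  have hinj := injective_of_surjective_endo f hsurj
  obtain ⟨ρ, hρ⟩ := hD.1.exists_hom h
  intro hw
  have hw1 : evalWord a D.2.2 = 1 := hinj (by rw [hfe, hw, map_one])
  rcases hD.2 with h1 | ⟨h1, k, hk, h2⟩
  · refine h1 ?_
    rw [← hρ, hw1, map_one]
    rfl
  -- The stabiliser `S` of `0` contains the words of the obstruction at `a`, and `f` sends these to
  -- `a`. So `f` maps `S` onto `G`; being injective, it forces every generator into `S`.
  · let S : Subgroup G := (MulAction.stabilizer (Equiv.Perm ℕ) 0).comap ρ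
    have hS : ∀ i : Fin n, evalWord a (D.2.1.getD i []) ∈ S := fun i => by
      change ρ _ 0 = 0
      rw [hρ, h1 i i.2]
    have hmap : S.map f = ⊤ := by
      rw [eq_top_iff]
      intro g _
      obtain ⟨w, rfl⟩ := h.exists_evalWord_eq g
      exact evalWord_mem (K := S.map f) a (fun i => ⟨_, hS i, hfa i⟩) w
    obtain ⟨s, hs, hsk⟩ : f (a ⟨k, hk⟩) ∈ S.map f := hmap ▸ Subgroup.mem_top _
    rw [hinj hsk] at hs
    have h3 : ρ (a ⟨k, hk⟩) 0 = 0 := hs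
    have h4 := hρ [k] 0
    rw [evalWord_singleton a ⟨k, hk⟩, h3] at h4
    rw [runWord_cons, Nat.mod_eq_of_lt hk] at h4
    exact h2 h4.symm

/-- The action on the cosets of a subgroup of finite index is described by a table. -/
theorem exists_isTable (ha : ∀ r ∈ R, evalWord a r = 1) (K : Subgroup G) [K.FiniteIndex] :
    ∃ d T, IsTable n R d T ∧ ∀ w, runWord n T w 0 = 0 ↔ evalWord a w ∈ K := by
  classical
  obtain ⟨d, ⟨e₀⟩⟩ := Finite.exists_equiv_fin (G ⧸ K)
  have hd : 0 < d := (e₀ (1 : G)).pos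
  -- The swap gives the coset `K` the number `0`, so that its stabiliser is `K`.
  let e : G ⧸ K ≃ Fin d := e₀.trans (Equiv.swap (e₀ (1 : G)) ⟨0, hd⟩)
  have he : (e ((1 : G) : G ⧸ K) : ℕ) = 0 := by simp [e]
  let T : List (List ℕ) := List.ofFn fun i : Fin n => List.ofFn fun x : Fin d =>
    (e (a i • e.symm x) : ℕ)
  have hrow : ∀ i : Fin n, T.getD i [] = List.ofFn fun x : Fin d => (e (a i • e.symm x) : ℕ) :=
    fun i => by simp [T, List.getD]
  have hrun : ∀ w (y : G ⧸ K), runWord n T w (e y) = e (evalWord a w • y) := fun w y => by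
    induction w with
    | nil => simp [runWord]
    | cons l w ih =>
      have h1 : l % n = (Fin.ofNat n l : ℕ) := rfl
      rw [runWord_cons, ih, tableMap, h1, hrow, evalWord_cons, mul_smul]
      simp
  refine ⟨d, T, ⟨fun l hl => ?_, fun x hx r hr => ?_⟩, fun w => ?_⟩
  · have := hrow ⟨l, hl⟩
    rw [this, List.length_ofFn]
  · have := hrun r (e.symm ⟨x, hx⟩)
    rwa [ha r hr, one_smul, Equiv.apply_symm_apply] at this
  · have h1 := hrun w ((1 : G) : G ⧸ K)
    rw [he] at h1
    rw [h1, ← he, Fin.val_inj, e.apply_eq_iff_eq, eq_comm]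
    refine QuotientGroup.eq.trans ?_
    simp

end

-- Unobstructed tuples

section

variable {n : ℕ} [NeZero n]

/-- The tuple `y` realises the obstruction `D` over the tuple `x`. -/
def Obstruction.Realizes {G : Type*} [Group G] (R : List (List ℕ)) (D : Obstruction)
    (x y : Fin n → G) : Prop :=
  (∀ r ∈ R, evalWord y r = 1) ∧ (∀ k : Fin n, evalWord y (D.2.1.getD k []) = x k) ∧
    evalWord y D.2.2 = 1

/-- The tuple `x` satisfies the relations and realises no valid obstruction. -/
def IsUnobstructed {G : Type*} [Group G] (R : List (List ℕ)) (x : Fin n → G) : Prop :=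
  (∀ r ∈ R, evalWord x r = 1) ∧
    ∀ D : Obstruction, D.IsValid n R → ∀ y, ¬ D.Realizes R x y

variable {G : Type*} [Group G] {a : Fin n → G} {R : List (List ℕ)}

theorem IsPresentedBy.isUnobstructed [WellFoundedGT (Subgroup G)] (h : IsPresentedBy a R) :
    IsUnobstructed R a :=
  ⟨fun _ hr => h.evalWord_eq_one hr, fun _ hD _ hy => hD.evalWord_ne_one h hy.1 hy.2.1 hy.2.2⟩

/-- If `z` were outside the subgroup generated by `x`, a subgroup `K` of finite index would contain
`x` but not `z`. The action on its cosets, with words expressing `x` in terms of `a`, is a valid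
obstruction realised by `a` itself; its last word is empty and so imposes nothing. -/
theorem IsUnobstructed.exists_evalWord_eq (h : IsPresentedBy a R) (hG : SubgroupSeparable G)
    {x : Fin n → G} (hx : IsUnobstructed R x) (z : G) : ∃ w, z = evalWord x w := by
  obtain ⟨f, hf⟩ := h.exists_hom hx.1
  have hfe : ∀ w, f (evalWord a w) = evalWord x w := fun w => by
    rw [map_evalWord]; simp only [hf]
  suffices hz : z ∈ f.range by
    obtain ⟨g, rfl⟩ := hz
    obtain ⟨w, rfl⟩ := h.exists_evalWord_eq g
    exact ⟨w, hfe w⟩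
  by_contra hz
  obtain ⟨K, hK, hKf, hzK⟩ := hG _ z hz
  obtain ⟨d, T, hT, hTK⟩ := exists_isTable (fun r hr => h.evalWord_eq_one hr) K
  choose u hu using fun k => h.exists_evalWord_eq (x k)
  have hus : ∀ k : Fin n, (List.ofFn u).getD k [] = u k := fun k => by simp [List.getD]
  refine hx.2 ((d, T), List.ofFn u, []) ⟨hT, Or.inr ⟨fun k hk => ?_, ?_⟩⟩ a
    ⟨fun r hr => h.evalWord_eq_one hr, fun k => ?_, rfl⟩
  · have := hus ⟨k, hk⟩
    rw [this, hTK, hu]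
    exact hK ⟨_, hf _⟩
  · by_contra! hcon
    obtain ⟨w, rfl⟩ := h.exists_evalWord_eq z
    refine hzK (evalWord_mem a (fun i => ?_) w)
    have := hTK [(i : ℕ)]
    rw [evalWord_singleton, runWord_cons, Nat.mod_eq_of_lt i.2] at this
    exact this.1 (hcon i i.2)
  · rw [hus, hu]

/-- A nontrivial `w` in the kernel of `G → M` survives modulo some subgroup of finite index, by
separability of `⊥`. With single letters as its tuple of words, the resulting obstruction is
realised by `x` over itself. -/
theorem IsUnobstructed.nonempty_mulEquiv (h : IsPresentedBy a R) (hG : SubgroupSeparable G)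
    {M : Type*} [Group M] {x : Fin n → M} (hx : IsUnobstructed R x)
    (hM : ∀ z, ∃ w, z = evalWord x w) : Nonempty (G ≃* M) := by
  obtain ⟨f, hf⟩ := h.exists_hom hx.1
  have hfe : ∀ w, f (evalWord a w) = evalWord x w := fun w => by
    rw [map_evalWord]; simp only [hf]
  refine ⟨MulEquiv.ofBijective f ⟨(injective_iff_map_eq_one f).2 fun g hg => ?_, fun z => ?_⟩⟩
  · by_contra hg1
    obtain ⟨w, rfl⟩ := h.exists_evalWord_eq g
    obtain ⟨K, -, hKf, hwK⟩ := hG ⊥ _ (by rwa [Subgroup.mem_bot])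
    obtain ⟨d, T, hT, hTK⟩ := exists_isTable (fun r hr => h.evalWord_eq_one hr) K
    refine hx.2 ((d, T), List.ofFn fun k : Fin n => [(k : ℕ)], w)
      ⟨hT, Or.inl fun h0 => hwK ((hTK w).1 h0)⟩ x ⟨hx.1, fun k => ?_, by rw [← hfe, hg]⟩
    have : (List.ofFn fun k : Fin n => [(k : ℕ)]).getD k [] = [(k : ℕ)] := by simp [List.getD]
    rw [this, evalWord_singleton]
  · obtain ⟨w, rfl⟩ := hM z
    exact ⟨_, hfe w⟩

end

/-! ### Primitive recursiveness of validity -/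

theorem primrecRel_forall_lt {β : Type*} [Primcodable β] {r : ℕ → β → Prop} (h : PrimrecRel r) :
    PrimrecRel fun (m : ℕ) b => ∀ x < m, r x b :=
  (h.forall_mem_list.comp (Primrec.list_range.comp Primrec.fst) Primrec.snd).of_eq (by simp)

theorem primrecRel_exists_lt {β : Type*} [Primcodable β] {r : ℕ → β → Prop} (h : PrimrecRel r) :
    PrimrecRel fun (m : ℕ) b => ∃ x < m, r x b :=
  (h.exists_mem_list.comp (Primrec.list_range.comp Primrec.fst) Primrec.snd).of_eq (by simp)

theorem primrec_tableMap :
    Primrec fun p : (List (List ℕ) × ℕ) × ℕ => tableMap p.1.1 p.1.2 p.2 :=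
  Primrec.option_getD.comp
    (Primrec.list_getElem?.comp
      ((Primrec.list_getD []).comp (Primrec.fst.comp Primrec.fst) (Primrec.snd.comp Primrec.fst))
      Primrec.snd)
    Primrec.snd

theorem primrec_runWord (n : ℕ) :
    Primrec fun p : (List (List ℕ) × List ℕ) × ℕ => runWord n p.1.1 p.1.2 p.2 := by
  refine Primrec.list_foldr (f := fun p : (List (List ℕ) × List ℕ) × ℕ => p.1.2)
    (g := fun p => p.2) (h := fun p q => tableMap p.1.1 (q.1 % n) q.2)
    (Primrec.snd.comp Primrec.fst) Primrec.snd ?_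
  exact primrec_tableMap.comp (Primrec.pair (Primrec.pair
    (Primrec.fst.comp (Primrec.fst.comp Primrec.fst))
    (Primrec.nat_mod.comp (Primrec.fst.comp Primrec.snd) (Primrec.const n)))
    (Primrec.snd.comp Primrec.snd))

theorem primrecPred_isTable (n : ℕ) (R : List (List ℕ)) :
    PrimrecPred fun p : ℕ × List (List ℕ) => IsTable n R p.1 p.2 := by
  refine PrimrecPred.and ?_ ?_
  · have h : PrimrecRel fun (l : ℕ) (p : ℕ × List (List ℕ)) => (p.2.getD l []).length ≤ p.1 :=
      Primrec.nat_le.comp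
        (Primrec.list_length.comp
          ((Primrec.list_getD []).comp (Primrec.snd.comp Primrec.snd) Primrec.fst))
        (Primrec.fst.comp Primrec.snd)
    exact (primrecRel_forall_lt h).comp (Primrec.const n) Primrec.id
  · have h : PrimrecRel fun (r : List ℕ) (p : List (List ℕ) × ℕ) => runWord n p.1 r p.2 = p.2 :=
      Primrec.eq.comp
        ((primrec_runWord n).comp (Primrec.pair
          (Primrec.pair (Primrec.fst.comp Primrec.snd) Primrec.fst)
          (Primrec.snd.comp Primrec.snd)))
        (Primrec.snd.comp Primrec.snd)
    have h' : PrimrecRel fun (x : ℕ) (T : List (List ℕ)) => ∀ r ∈ R, runWord n T r x = x :=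
      h.forall_mem_list.comp (Primrec.const R) (Primrec.pair Primrec.snd Primrec.fst)
    exact (primrecRel_forall_lt h').comp Primrec.fst Primrec.snd

/-- Validity only concerns the finite table: all quantifiers are bounded, and the word problem of
`G` plays no role. -/
theorem primrecPred_isValid (n : ℕ) (R : List (List ℕ)) :
    PrimrecPred fun D : Obstruction => D.IsValid n R := by
  have hT : Primrec fun D : Obstruction => D.1.2 := Primrec.snd.comp Primrec.fst
  refine ((primrecPred_isTable n R).comp Primrec.fst).and
    (PrimrecPred.or ?_ (PrimrecPred.and ?_ ?_))
  · exact (Primrec.eq.comp ((primrec_runWord n).comp (Primrec.pair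
      (Primrec.pair hT (Primrec.snd.comp Primrec.snd)) (Primrec.const 0))) (Primrec.const 0)).not
  · have h : PrimrecRel fun (k : ℕ) (D : Obstruction) =>
        runWord n D.1.2 (D.2.1.getD k []) 0 = 0 :=
      Primrec.eq.comp ((primrec_runWord n).comp (Primrec.pair
        (Primrec.pair (hT.comp Primrec.snd) ((Primrec.list_getD []).comp
          (Primrec.fst.comp (Primrec.snd.comp Primrec.snd)) Primrec.fst))
        (Primrec.const 0))) (Primrec.const 0)
    exact (primrecRel_forall_lt h).comp (Primrec.const n) Primrec.id
  · have h : PrimrecRel fun (k : ℕ) (D : Obstruction) => tableMap D.1.2 k 0 ≠ 0 :=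
      PrimrecPred.not (Primrec.eq.comp (primrec_tableMap.comp (Primrec.pair
        (Primrec.pair (hT.comp Primrec.snd) Primrec.fst) (Primrec.const 0))) (Primrec.const 0))
    exact (primrecRel_exists_lt h).comp (Primrec.const n) Primrec.id

open InfFormula

/-! ### Formulas: satisfaction -/

section Realize

variable {M : Type*} [groupLang.Structure M]

theorem realize_exs (xs : List ℕ) (φ : InfFormula) (v : ℕ → M) :
    (exs xs φ).Realize v ↔ ∃ v' : ℕ → M, (∀ k, k ∉ xs → v' k = v k) ∧ φ.Realize v' := by
  induction xs generalizing v with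
  | nil =>
    refine ⟨fun h => ⟨v, fun _ _ => rfl, h⟩, ?_⟩
    rintro ⟨v', h, h'⟩
    rwa [funext fun k => h k List.not_mem_nil] at h'
  | cons x xs ih =>
    change (∃ a : M, (exs xs φ).Realize (Function.update v x a)) ↔ _
    simp only [ih]
    constructor
    · rintro ⟨b, v', h, h'⟩
      refine ⟨v', fun k hk => ?_, h'⟩
      rw [List.mem_cons, not_or] at hk
      rw [h k hk.2, Function.update_of_ne hk.1]
    · rintro ⟨v', h, h'⟩
      refine ⟨v' x, v', fun k hk => ?_, h'⟩
      by_cases hkx : k = x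
      · subst hkx; rw [Function.update_self]
      · rw [Function.update_of_ne hkx]
        exact h k (by simp [hkx, hk])

theorem realize_alls (xs : List ℕ) (φ : InfFormula) (v : ℕ → M) :
    (alls xs φ).Realize v ↔ ∀ v' : ℕ → M, (∀ k, k ∉ xs → v' k = v k) → φ.Realize v' := by
  induction xs generalizing v with
  | nil =>
    refine ⟨fun h v' hv' => ?_, fun h => h v fun _ _ => rfl⟩
    rwa [funext fun k => hv' k List.not_mem_nil]
  | cons x xs ih =>
    change (∀ a : M, (alls xs φ).Realize (Function.update v x a)) ↔ _
    simp only [ih]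
    constructor
    · intro h v' hv'
      refine h (v' x) v' fun k hk => ?_
      by_cases hkx : k = x
      · subst hkx; rw [Function.update_self]
      · rw [Function.update_of_ne hkx]
        exact hv' k (by simp [hkx, hk])
    · intro h b v' hv'
      refine h v' fun k hk => ?_
      rw [List.mem_cons, not_or] at hk
      rw [hv' k hk.2, Function.update_of_ne hk.1]

theorem realize_equiv {N : Type*} [groupLang.Structure N] (e : groupLang.Equiv M N)
    (φ : InfFormula) (v : ℕ → M) : φ.Realize v ↔ φ.Realize (e ∘ v) := by
  induction φ generalizing v with
  | equal s t =>
    simp only [Realize, FirstOrder.Language.HomClass.realize_term]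
    exact e.injective.eq_iff.symm
  | neg φ ih => exact not_congr (ih v)
  | and φ ψ ih₁ ih₂ => exact and_congr (ih₁ v) (ih₂ v)
  | or φ ψ ih₁ ih₂ => exact or_congr (ih₁ v) (ih₂ v)
  | all x φ ih =>
    simp only [Realize, ih, Function.comp_update]
    exact (e.surjective.forall (p := fun b => φ.Realize (Function.update (e ∘ v) x b))).symm
  | ex x φ ih =>
    simp only [Realize, ih, Function.comp_update]
    exact (e.surjective.exists (p := fun b => φ.Realize (Function.update (e ∘ v) x b))).symm
  | bigAnd I f ih => exact forall_congr' fun i => ih i v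
  | bigOr I f ih => exact exists_congr fun i => ih i v

end Realize

/-! ### Formulas: free variables -/

theorem freeVars_exs (xs : List ℕ) (φ : InfFormula) :
    (exs xs φ).freeVars = φ.freeVars \ {x | x ∈ xs} := by
  induction xs with
  | nil => simp [exs]
  | cons x xs ih =>
    change (exs xs φ).freeVars \ {x} = _
    rw [ih, Set.sdiff_sdiff]
    congr 1
    ext k
    simp

theorem freeVars_alls (xs : List ℕ) (φ : InfFormula) :
    (alls xs φ).freeVars = φ.freeVars \ {x | x ∈ xs} := by
  induction xs with
  | nil => simp [alls]
  | cons x xs ih =>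
    change (alls xs φ).freeVars \ {x} = _
    rw [ih, Set.sdiff_sdiff]
    congr 1
    ext k
    simp

/-! ### Uniformly coded families of formulas -/

/-- A primitive recursive function gives codes of the members of the family. -/
def UniformlyCoded {α : Type*} [Primcodable α] (f : α → InfFormula) : Prop :=
  ∃ g : α → ℕ, Primrec g ∧ ∀ i, HasCode (f i) (g i)

/-- A primitive recursive function gives the Gödel numbers of the members of the family. -/
def TermsCoded {α : Type*} [Primcodable α] (t : α → GTerm) : Prop :=
  Primrec fun i => termCode (t i)

namespace UniformlyCoded

variable {α : Type*} [Primcodable α] {f f' : α → InfFormula}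

theorem const {φ : InfFormula} (h : φ.IsComputable) : UniformlyCoded fun _ : α => φ := by
  obtain ⟨k, hk⟩ := h
  exact ⟨fun _ => k, Primrec.const k, fun _ => hk⟩

theorem equal {s t : α → GTerm} (hs : TermsCoded s) (ht : TermsCoded t) :
    UniformlyCoded fun i => InfFormula.equal (s i) (t i) :=
  ⟨_, Primrec₂.natPair.comp (Primrec.const 0) (Primrec₂.natPair.comp hs ht), fun _ => .equal _ _⟩

theorem neg (h : UniformlyCoded f) : UniformlyCoded fun i => (f i).neg := by
  obtain ⟨g, hg, hc⟩ := h
  exact ⟨_, Primrec₂.natPair.comp (Primrec.const 1) hg, fun i => .neg (hc i)⟩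

theorem and (h : UniformlyCoded f) (h' : UniformlyCoded f') :
    UniformlyCoded fun i => (f i).and (f' i) := by
  obtain ⟨g, hg, hc⟩ := h
  obtain ⟨g', hg', hc'⟩ := h'
  exact ⟨_, Primrec₂.natPair.comp (Primrec.const 2) (Primrec₂.natPair.comp hg hg'),
    fun i => .and (hc i) (hc' i)⟩

theorem or (h : UniformlyCoded f) (h' : UniformlyCoded f') :
    UniformlyCoded fun i => (f i).or (f' i) := by
  obtain ⟨g, hg, hc⟩ := h
  obtain ⟨g', hg', hc'⟩ := h'
  exact ⟨_, Primrec₂.natPair.comp (Primrec.const 3) (Primrec₂.natPair.comp hg hg'),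
    fun i => .or (hc i) (hc' i)⟩

theorem alls (xs : List ℕ) (h : UniformlyCoded f) :
    UniformlyCoded fun i => InfFormula.alls xs (f i) := by
  induction xs with
  | nil => exact h
  | cons x xs ih =>
    obtain ⟨g, hg, hc⟩ := ih
    exact ⟨_, Primrec₂.natPair.comp (Primrec.const 4) (Primrec₂.natPair.comp (Primrec.const x) hg),
      fun i => .all x (hc i)⟩

theorem exs (xs : List ℕ) (h : UniformlyCoded f) :
    UniformlyCoded fun i => InfFormula.exs xs (f i) := by
  induction xs with
  | nil => exact h
  | cons x xs ih =>
    obtain ⟨g, hg, hc⟩ := ih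
    exact ⟨_, Primrec₂.natPair.comp (Primrec.const 5) (Primrec₂.natPair.comp (Primrec.const x) hg),
      fun i => .ex x (hc i)⟩

theorem ite {c : α → Prop} [DecidablePred c] (hc : PrimrecPred c) (h : UniformlyCoded f)
    (h' : UniformlyCoded f') : UniformlyCoded fun i => if c i then f i else f' i := by
  obtain ⟨g, hg, hc₁⟩ := h
  obtain ⟨g', hg', hc₂⟩ := h'
  refine ⟨_, Primrec.ite hc hg hg', fun i => ?_⟩
  by_cases hi : c i
  · simpa only [if_pos hi] using hc₁ i
  · simpa only [if_neg hi] using hc₂ i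

theorem comp {β : Type*} [Primcodable β] (h : UniformlyCoded f) {e : β → α} (he : Primrec e) :
    UniformlyCoded fun i => f (e i) := by
  obtain ⟨g, hg, hc⟩ := h
  exact ⟨_, hg.comp he, fun i => hc (e i)⟩

/-- Primitive recursive codes are total, so the index set is all of `ℕ`. The families below are
padded with trivial or repeated members to fit this. -/
theorem isComputable_bigAnd {f : ℕ → InfFormula} (h : UniformlyCoded f) :
    (bigAnd Set.univ fun i => f i).IsComputable := by
  obtain ⟨g, hg, hc⟩ := h
  obtain ⟨c, hcode⟩ := Nat.Partrec.Code.exists_code.1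
    (Nat.Partrec.of_primrec (Primrec.nat_iff.1 hg))
  refine ⟨_, .bigAnd c _ (fun i => g i) (fun i => ?_) (fun i => ?_) fun i => hc i⟩
  · simp [hcode]
  · simp [hcode]

theorem isComputable_bigOr {f : ℕ → InfFormula} (h : UniformlyCoded f) :
    (bigOr Set.univ fun i => f i).IsComputable := by
  obtain ⟨g, hg, hc⟩ := h
  obtain ⟨c, hcode⟩ := Nat.Partrec.Code.exists_code.1
    (Nat.Partrec.of_primrec (Primrec.nat_iff.1 hg))
  refine ⟨_, .bigOr c _ (fun i => g i) (fun i => ?_) (fun i => ?_) fun i => hc i⟩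
  · simp [hcode]
  · simp [hcode]

end UniformlyCoded

theorem isComputable_of_isQF {φ : InfFormula} (h : φ.IsQF) : φ.IsComputable := by
  induction φ with
  | equal s t => exact ⟨_, .equal s t⟩
  | neg φ ih =>
    obtain ⟨k, hk⟩ := ih h
    exact ⟨_, .neg hk⟩
  | and φ ψ ih₁ ih₂ =>
    obtain ⟨k, hk⟩ := ih₁ h.1
    obtain ⟨l, hl⟩ := ih₂ h.2
    exact ⟨_, .and hk hl⟩
  | or φ ψ ih₁ ih₂ =>
    obtain ⟨k, hk⟩ := ih₁ h.1
    obtain ⟨l, hl⟩ := ih₂ h.2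
    exact ⟨_, .or hk hl⟩
  | all | ex | bigAnd | bigOr => exact h.elim

/-! ### Word terms and finite conjunctions -/

/-- The term `1`. -/
def oneTerm : GTerm := .func GroupFunc.one ![]

/-- The product of two terms. -/
def mulTerm (s t : GTerm) : GTerm := .func GroupFunc.mul ![s, t]

/-- The inverse of a term. -/
def invTerm (t : GTerm) : GTerm := .func GroupFunc.inv ![t]

/-- The term for a word whose letters, read modulo `n`, stand for `x_o, …, x_{o+n-1}`. -/
def wordTerm (o n : ℕ) (w : List ℕ) : GTerm :=
  w.foldr (fun l t => mulTerm (.var (o + l % n)) t) oneTerm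

/-- A finite conjunction. -/
def conj (L : List InfFormula) : InfFormula := L.foldr .and (.equal oneTerm oneTerm)

section

variable {G : Type*} [Group G]

@[simp]
theorem realize_oneTerm (v : ℕ → G) : oneTerm.realize v = 1 := rfl

theorem realize_wordTerm (o : ℕ) {n : ℕ} [NeZero n] (w : List ℕ) (v : ℕ → G) :
    (wordTerm o n w).realize v = evalWord (fun i : Fin n => v (o + i)) w := by
  induction w with
  | nil => rfl
  | cons l w ih =>
    rw [evalWord_cons, ← ih]
    rfl

theorem realize_conj (L : List InfFormula) (v : ℕ → G) :
    (conj L).Realize v ↔ ∀ φ ∈ L, φ.Realize v := by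
  induction L with
  | nil => simp [conj, Realize]
  | cons φ L ih =>
    rw [List.forall_mem_cons, ← ih]
    rfl

end

theorem varFinset_oneTerm : oneTerm.varFinset = ∅ := rfl

theorem varFinset_mulTerm (s t : GTerm) :
    (mulTerm s t).varFinset = s.varFinset ∪ t.varFinset := by
  ext k
  simp [mulTerm, FirstOrder.Language.Term.varFinset]

theorem varFinset_invTerm (t : GTerm) : (invTerm t).varFinset = t.varFinset := by
  ext k
  simp [invTerm, FirstOrder.Language.Term.varFinset]

theorem lt_of_mem_varFinset_wordTerm {o n : ℕ} [NeZero n] {w : List ℕ} {k : ℕ}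
    (hk : k ∈ (wordTerm o n w).varFinset) : k < o + n := by
  induction w with
  | nil => exact absurd hk (Finset.notMem_empty k)
  | cons l w ih =>
    change k ∈ (mulTerm _ _).varFinset at hk
    rw [varFinset_mulTerm, Finset.mem_union] at hk
    rcases hk with hk | hk
    · rw [Finset.mem_singleton.1 hk]
      have := Nat.mod_lt l (Nat.pos_of_neZero n)
      omega
    · exact ih hk

theorem freeVars_conj (L : List InfFormula) :
    (conj L).freeVars = {k | ∃ φ ∈ L, k ∈ φ.freeVars} := by
  induction L with
  | nil => simp [conj, freeVars, varFinset_oneTerm]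
  | cons φ L ih =>
    change φ.freeVars ∪ (conj L).freeVars = _
    rw [ih]
    ext k
    simp

theorem isQF_conj {L : List InfFormula} (h : ∀ φ ∈ L, φ.IsQF) : (conj L).IsQF := by
  induction L with
  | nil => trivial
  | cons φ L ih =>
    rw [List.forall_mem_cons] at h
    exact ⟨h.1, ih h.2⟩

theorem TermsCoded.const {α : Type*} [Primcodable α] (t : GTerm) : TermsCoded fun _ : α => t :=
  Primrec.const _

theorem termsCoded_wordTerm (o n : ℕ) : TermsCoded (wordTerm o n) := by
  have h : Primrec fun w : List ℕ => w.foldr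
      (fun l c => Nat.pair 3 (Nat.pair (Nat.pair 0 (o + l % n)) c)) (Nat.pair 1 0) := by
    refine Primrec.list_foldr (f := fun w : List ℕ => w) (g := fun _ => Nat.pair 1 0)
      (h := fun _ p => Nat.pair 3 (Nat.pair (Nat.pair 0 (o + p.1 % n)) p.2))
      Primrec.id (Primrec.const _) ?_
    exact Primrec₂.natPair.comp (Primrec.const 3) (Primrec₂.natPair.comp
      (Primrec₂.natPair.comp (Primrec.const 0) (Primrec.nat_add.comp (Primrec.const o)
        (Primrec.nat_mod.comp (Primrec.fst.comp Primrec.snd) (Primrec.const n))))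
      (Primrec.snd.comp Primrec.snd))
  refine h.of_eq fun w => ?_
  induction w with
  | nil => rfl
  | cons l w ih =>
    rw [List.foldr_cons, ih]
    rfl

theorem TermsCoded.comp {α β : Type*} [Primcodable α] [Primcodable β] {t : α → GTerm}
    (h : TermsCoded t) {e : β → α} (he : Primrec e) : TermsCoded fun i => t (e i) :=
  Primrec.comp (f := fun i => termCode (t i)) h he

theorem UniformlyCoded.conj {α ι : Type*} [Primcodable α] {f : ι → α → InfFormula}
    (h : ∀ j, UniformlyCoded (f j)) (L : List ι) :
    UniformlyCoded fun i => ScottGroup.conj (L.map fun j => f j i) := by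
  induction L with
  | nil => exact .const (isComputable_of_isQF trivial)
  | cons j L ih => exact (h j).and ih

/-! ### The group axioms -/

/-- The conjunction of the matrices of the group axioms. -/
def groupAxioms : InfFormula :=
  .and (.equal (mulTerm (mulTerm (.var 0) (.var 1)) (.var 2))
      (mulTerm (.var 0) (mulTerm (.var 1) (.var 2))))
    (.and (.equal (mulTerm oneTerm (.var 0)) (.var 0))
      (.equal (mulTerm (invTerm (.var 0)) (.var 0)) oneTerm))

theorem realize_groupAxioms {G : Type*} [Group G] (v : ℕ → G) : groupAxioms.Realize v :=
  ⟨mul_assoc _ _ _, one_mul _, inv_mul_cancel _⟩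

theorem isQF_groupAxioms : groupAxioms.IsQF := ⟨trivial, trivial, trivial⟩

theorem freeVars_groupAxioms : groupAxioms.freeVars ⊆ {k | k < 3} := by
  intro k hk
  simp only [groupAxioms, freeVars, varFinset_mulTerm, varFinset_invTerm, varFinset_oneTerm,
    FirstOrder.Language.Term.varFinset, Set.mem_union, Finset.mem_coe, Finset.mem_union,
    Finset.mem_singleton, Finset.notMem_empty, or_false, false_or] at hk
  change k < 3
  omega

/-- A structure that satisfies the group axioms comes from a group. -/
theorem exists_eq_groupStructure {M : Type*} [S : groupLang.Structure M]
    (h : ∀ v : ℕ → M, groupAxioms.Realize v) : ∃ g : Group M, S = @groupStructure M g := by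
  let mul : M → M → M := fun a b => S.funMap (n := 2) GroupFunc.mul ![a, b]
  let inv : M → M := fun a => S.funMap (n := 1) GroupFunc.inv ![a]
  let one : M := S.funMap (n := 0) GroupFunc.one ![]
  have hone : ∀ v : ℕ → M, oneTerm.realize v = one := fun v =>
    congrArg (S.funMap (n := 0) GroupFunc.one) (Subsingleton.elim _ _)
  have hinv : ∀ (t : GTerm) (v : ℕ → M), (invTerm t).realize v = inv (t.realize v) := fun t v =>
    congrArg (S.funMap (n := 1) GroupFunc.inv) (funext fun i => by fin_cases i; rfl)
  have hmul : ∀ (s t : GTerm) (v : ℕ → M),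
      (mulTerm s t).realize v = mul (s.realize v) (t.realize v) := fun s t v =>
    congrArg (S.funMap (n := 2) GroupFunc.mul) (funext fun i => by fin_cases i <;> rfl)
  have hax : ∀ a b c : M, mul (mul a b) c = mul a (mul b c) ∧ mul one a = a ∧
      mul (inv a) a = one := fun a b c => by
    have := h fun k => if k = 0 then a else if k = 1 then b else c
    simpa [groupAxioms, Realize, hone, hinv, hmul] using this
  let : Mul M := ⟨mul⟩
  let : Inv M := ⟨inv⟩
  let : One M := ⟨one⟩
  refine ⟨Group.ofLeftAxioms (fun a b c => (hax a b c).1) (fun a => (hax a a a).2.1)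
    (fun a => (hax a a a).2.2), ?_⟩
  refine FirstOrder.Language.Structure.ext ?_ ?_
  · funext k f x
    cases f with
    | one => exact congrArg (S.funMap (n := 0) GroupFunc.one) (Subsingleton.elim _ _)
    | inv => exact congrArg (S.funMap (n := 1) GroupFunc.inv) (funext fun i => by fin_cases i; rfl)
    | mul =>
      exact congrArg (S.funMap (n := 2) GroupFunc.mul) (funext fun i => by fin_cases i <;> rfl)
  · funext k r
    exact r.elim

/-- An isomorphism of groups is an isomorphism of structures. -/
def structureEquiv {G : Type*} {H : Type*} [Group G] [Group H] (e : G ≃* H) :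
    groupLang.Equiv G H where
  toEquiv := e.toEquiv
  map_fun' := fun f x => by
    cases f with
    | one => exact map_one e
    | inv => exact map_inv e _
    | mul => exact map_mul e _ _
  map_rel' := fun r => r.elim

/-! ### The Scott sentence -/

section

variable (n : ℕ) (R : List (List ℕ))

/-- The relations in `R` hold for the variables `x_o, …, x_{o+n-1}`. -/
def relationsFormula (o : ℕ) : InfFormula :=
  conj (R.map fun r => .equal (wordTerm o n r) oneTerm)

/-- The variables `x_n, …, x_{2n-1}` realise the obstruction `D` over `x_0, …, x_{n-1}`. -/
def realizesFormula (D : Obstruction) : InfFormula :=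
  .and (relationsFormula n R n)
    (.and (conj ((List.range n).map fun k => .equal (wordTerm n n (D.2.1.getD k [])) (.var k)))
      (.equal (wordTerm n n D.2.2) oneTerm))

open Classical in
/-- The variables `x_0, …, x_{n-1}` satisfy the relations, and `D` is not a valid obstruction that
is realised over them by `x_n, …, x_{2n-1}`. -/
noncomputable def avoidsFormula (D : Obstruction) : InfFormula :=
  -- The relations are repeated for every `D`, which keeps each conjunct quantifier-free. An invalid
  -- obstruction contributes a trivial equation, so that all indices can be used.
  .and (relationsFormula n R 0)
    (if D.IsValid n R then .neg (realizesFormula n R D) else .equal oneTerm oneTerm)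

/-- The tuple `x_0, …, x_{n-1}` is unobstructed. -/
noncomputable def unobstructedFormula : InfFormula :=
  bigAnd Set.univ fun i => alls (List.range' n n)
    (avoidsFormula n R (Denumerable.ofNat Obstruction i))

/-- If `x_0, …, x_{n-1}` is unobstructed, then `x_{2n}` is the value of a word at it. -/
noncomputable def generatesFormula : InfFormula :=
  bigOr Set.univ fun i => exs (List.range' n n)
    -- One index serves both alternatives: as an obstruction witnessing that the tuple is
    -- obstructed, and through its last component as a word for `x_{2n}`.
    (.or (.neg (avoidsFormula n R (Denumerable.ofNat Obstruction i)))
      (.equal (.var (2 * n)) (wordTerm 0 n (Denumerable.ofNat Obstruction i).2.2)))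

/-- There is an unobstructed tuple. -/
noncomputable def existsFormula : InfFormula :=
  bigOr Set.univ fun _ => exs (List.range n) (unobstructedFormula n R)

/-- The group axioms hold, and every unobstructed tuple generates. -/
noncomputable def universalFormula : InfFormula :=
  bigAnd Set.univ fun i => alls (if (i : ℕ) = 0 then [0, 1, 2] else 2 * n :: List.range n)
    (if (i : ℕ) = 0 then groupAxioms else generatesFormula n R)

/-- The Scott sentence of a group presented by the relations `R` between `n` generators. -/
noncomputable def scottSentence : InfFormula := .and (existsFormula n R) (universalFormula n R)

-- Complexity and computability of the Scott sentence

variable {n R}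

theorem isQF_relationsFormula (o : ℕ) : (relationsFormula n R o).IsQF :=
  isQF_conj fun φ hφ => by
    obtain ⟨r, -, rfl⟩ := List.mem_map.1 hφ
    trivial

theorem isQF_realizesFormula (D : Obstruction) : (realizesFormula n R D).IsQF :=
  ⟨isQF_relationsFormula n, isQF_conj fun φ hφ => by
    obtain ⟨r, -, rfl⟩ := List.mem_map.1 hφ
    trivial, trivial⟩

theorem isQF_avoidsFormula (D : Obstruction) : (avoidsFormula n R D).IsQF := by
  refine ⟨isQF_relationsFormula 0, ?_⟩
  split_ifs
  · exact isQF_realizesFormula D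
  · trivial

theorem isDSigma_scottSentence : IsDSigma 2 (scottSentence n R) := by
  have hP : IsPi 1 (unobstructedFormula n R) :=
    .succ _ _ (fun _ => 0) (fun _ => by omega) fun _ => .zero (isQF_avoidsFormula _)
  have hS : IsSigma 1 (generatesFormula n R) :=
    .succ _ _ (fun _ => 0) (fun _ => by omega) fun _ => .zero ⟨isQF_avoidsFormula _, trivial⟩
  refine ⟨_, _, .succ _ _ (fun _ => 1) (fun _ => by omega) fun _ => hP,
    .succ _ _ (fun i => if (i : ℕ) = 0 then 0 else 1) (fun i => ?_) (fun i => ?_), rfl⟩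
  · split_ifs <;> omega
  · split_ifs
    · exact .zero isQF_groupAxioms
    · exact hS

/-- The classical case distinction in `avoidsFormula` is harmless because validity is primitive
recursive. -/
theorem uniformlyCoded_avoidsFormula : UniformlyCoded (avoidsFormula n R) := by
  classical
  have hc : ∀ o, (relationsFormula n R o).IsComputable := fun o =>
    isComputable_of_isQF (isQF_relationsFormula o)
  refine (UniformlyCoded.const (hc 0)).and (.ite (primrecPred_isValid n R) (.neg
    ((UniformlyCoded.const (hc n)).and (.and (.conj (fun k => .equal ?_ (.const _)) _)
      (.equal ((termsCoded_wordTerm n n).comp (Primrec.snd.comp Primrec.snd)) (.const _)))))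
    (.const (isComputable_of_isQF trivial)))
  exact (termsCoded_wordTerm n n).comp ((Primrec.list_getD []).comp
    (Primrec.fst.comp Primrec.snd) (Primrec.const k))

theorem isComputable_scottSentence : IsComputable (scottSentence n R) := by
  have hD : Primrec (Denumerable.ofNat Obstruction) := Primrec.ofNat _
  have ha := (uniformlyCoded_avoidsFormula (n := n) (R := R)).comp hD
  have h1 : (unobstructedFormula n R).IsComputable := (ha.alls _).isComputable_bigAnd
  have h2 : (generatesFormula n R).IsComputable :=
    ((ha.neg.or (.equal (.const _) ((termsCoded_wordTerm 0 n).comp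
      (Primrec.snd.comp (Primrec.snd.comp hD))))).exs _).isComputable_bigOr
  obtain ⟨k, hk⟩ : (existsFormula n R).IsComputable :=
    ((UniformlyCoded.const h1).exs _).isComputable_bigOr
  have h3 : UniformlyCoded fun i : ℕ => if i = 0 then InfFormula.alls [0, 1, 2] groupAxioms else
      InfFormula.alls (2 * n :: List.range n) (generatesFormula n R) :=
    .ite (Primrec.eq.comp Primrec.id (Primrec.const 0))
      ((UniformlyCoded.const (isComputable_of_isQF isQF_groupAxioms)).alls _)
      ((UniformlyCoded.const h2).alls _)
  obtain ⟨l, hl⟩ := h3.isComputable_bigAnd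
  have h4 : universalFormula n R = bigAnd Set.univ fun i : Set.univ => if (i : ℕ) = 0 then
      InfFormula.alls [0, 1, 2] groupAxioms else
      InfFormula.alls (2 * n :: List.range n) (generatesFormula n R) := by
    rw [universalFormula]
    congr 1
    funext i
    split_ifs <;> rfl
  exact ⟨_, .and hk (h4 ▸ hl)⟩

-- Free variables of the Scott sentence

variable [NeZero n]

theorem lt_of_mem_freeVars_relationsFormula {o k : ℕ}
    (hk : k ∈ (relationsFormula n R o).freeVars) : k < o + n := by
  rw [relationsFormula, freeVars_conj] at hk
  obtain ⟨φ, hφ, hk⟩ := hk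
  obtain ⟨r, -, rfl⟩ := List.mem_map.1 hφ
  simp only [freeVars, varFinset_oneTerm, Finset.union_empty, Finset.mem_coe] at hk
  exact lt_of_mem_varFinset_wordTerm hk

theorem lt_of_mem_freeVars_avoidsFormula {D : Obstruction} {k : ℕ}
    (hk : k ∈ (avoidsFormula n R D).freeVars) : k < 2 * n := by
  rcases hk with hk | hk
  · have := lt_of_mem_freeVars_relationsFormula hk
    omega
  split_ifs at hk
  · rcases hk with hk | hk | hk
    · have := lt_of_mem_freeVars_relationsFormula hk
      omega
    · rw [freeVars_conj] at hk
      obtain ⟨φ, hφ, hk⟩ := hk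
      obtain ⟨j, hj, rfl⟩ := List.mem_map.1 hφ
      simp only [freeVars, Finset.mem_coe, Finset.mem_union] at hk
      rcases hk with hk | hk
      · have := lt_of_mem_varFinset_wordTerm hk
        omega
      · rw [Finset.mem_singleton.1 hk]
        have := List.mem_range.1 hj
        omega
    · simp only [freeVars, varFinset_oneTerm, Finset.union_empty, Finset.mem_coe] at hk
      have := lt_of_mem_varFinset_wordTerm hk
      omega
  · simp [freeVars, varFinset_oneTerm] at hk

theorem lt_of_mem_freeVars_unobstructedFormula {k : ℕ}
    (hk : k ∈ (unobstructedFormula n R).freeVars) : k < n := by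
  simp only [unobstructedFormula, freeVars, Set.mem_iUnion, freeVars_alls] at hk
  obtain ⟨i, hk, hk'⟩ := hk
  have := lt_of_mem_freeVars_avoidsFormula hk
  simp only [Set.mem_ofPred_eq, List.mem_range'_1] at hk'
  omega

theorem le_of_mem_freeVars_generatesFormula {k : ℕ}
    (hk : k ∈ (generatesFormula n R).freeVars) : k < n ∨ k = 2 * n := by
  simp only [generatesFormula, freeVars, Set.mem_iUnion, freeVars_exs] at hk
  obtain ⟨i, hk | hk, hk'⟩ := hk
  · have := lt_of_mem_freeVars_avoidsFormula hk
    simp only [Set.mem_ofPred_eq, List.mem_range'_1] at hk'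
    omega
  · rw [Finset.mem_coe, Finset.mem_union] at hk
    rcases hk with hk | hk
    · exact Or.inr (Finset.mem_singleton.1 hk)
    · have := lt_of_mem_varFinset_wordTerm hk
      omega

theorem isSentence_scottSentence : IsSentence (scottSentence n R) := by
  rw [IsSentence, Set.eq_empty_iff_forall_notMem]
  rintro k (hk | hk)
  · simp only [existsFormula, freeVars, Set.mem_iUnion, freeVars_exs] at hk
    obtain ⟨-, hk, hk'⟩ := hk
    exact hk' (List.mem_range.2 (lt_of_mem_freeVars_unobstructedFormula hk))
  · simp only [universalFormula, freeVars, Set.mem_iUnion, freeVars_alls] at hk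
    obtain ⟨i, hk, hk'⟩ := hk
    split_ifs at hk hk'
    · have : k < 3 := freeVars_groupAxioms hk
      simp only [Set.mem_ofPred_eq, List.mem_cons, List.not_mem_nil] at hk'
      omega
    · have := le_of_mem_freeVars_generatesFormula hk
      simp only [Set.mem_ofPred_eq, List.mem_cons, List.mem_range] at hk'
      omega

-- Meaning of the Scott sentence in a group

section

variable {G : Type*} [Group G]

theorem realize_relationsFormula (o : ℕ) (v : ℕ → G) : (relationsFormula n R o).Realize v ↔
    ∀ r ∈ R, evalWord (fun i : Fin n => v (o + i)) r = 1 := by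
  simp [relationsFormula, realize_conj, Realize, realize_wordTerm]

theorem realize_realizesFormula (D : Obstruction) (v : ℕ → G) :
    (realizesFormula n R D).Realize v ↔
      D.Realizes R (fun i : Fin n => v i) (fun i : Fin n => v (n + i)) := by
  simp only [realizesFormula, Realize, realize_relationsFormula, realize_conj,
    Obstruction.Realizes, realize_wordTerm, realize_oneTerm, List.forall_mem_map, List.mem_range,
    Fin.forall_iff]
  rfl

theorem realize_avoidsFormula (D : Obstruction) (v : ℕ → G) :
    (avoidsFormula n R D).Realize v ↔ (∀ r ∈ R, evalWord (fun i : Fin n => v i) r = 1) ∧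
      (D.IsValid n R → ¬ D.Realizes R (fun i : Fin n => v i) (fun i : Fin n => v (n + i))) := by
  rw [avoidsFormula, Realize, realize_relationsFormula]
  refine and_congr (by simp) ?_
  split_ifs with h
  · simp [Realize, realize_realizesFormula, h]
  · simp [Realize, h]

theorem realize_unobstructedFormula (v : ℕ → G) :
    (unobstructedFormula n R).Realize v ↔ IsUnobstructed R fun i : Fin n => v i := by
  have hx : ∀ v' : ℕ → G, (∀ k, k ∉ List.range' n n → v' k = v k) →
      (fun i : Fin n => v' i) = fun i : Fin n => v i := fun v' hv' => funext fun i =>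
    hv' _ (by rw [List.mem_range'_1]; have := i.2; omega)
  simp only [unobstructedFormula, Realize, realize_alls, realize_avoidsFormula]
  constructor
  · intro h
    refine ⟨(h ⟨0, trivial⟩ v fun _ _ => rfl).1, fun D hD y hy => ?_⟩
    let v' : ℕ → G := fun k => if h : n ≤ k ∧ k - n < n then y ⟨k - n, h.2⟩ else v k
    have hv' : ∀ k, k ∉ List.range' n n → v' k = v k := fun k hk => by
      rw [List.mem_range'_1] at hk
      exact dif_neg (by omega)
    have := (h ⟨Encodable.encode D, trivial⟩ v' hv').2
    rw [Denumerable.ofNat_encode, hx v' hv'] at this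
    refine this hD ?_
    convert hy using 1
    funext i
    simp [v']
  · intro h i v' hv'
    rw [hx v' hv']
    exact ⟨h.1, fun hD => h.2 _ hD _⟩

theorem realize_generatesFormula (v : ℕ → G) : (generatesFormula n R).Realize v ↔
    (IsUnobstructed R (fun i : Fin n => v i) →
      ∃ w, v (2 * n) = evalWord (fun i : Fin n => v i) w) := by
  have hu := realize_unobstructedFormula (R := R) (n := n) v
  have hx : ∀ v' : ℕ → G, (∀ k, k ∉ List.range' n n → v' k = v k) →
      (fun i : Fin n => v' i) = fun i : Fin n => v i := fun v' hv' => funext fun i =>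
    hv' _ (by rw [List.mem_range'_1]; have := i.2; omega)
  have hz : ∀ v' : ℕ → G, (∀ k, k ∉ List.range' n n → v' k = v k) → v' (2 * n) = v (2 * n) :=
    fun v' hv' => hv' _ (by rw [List.mem_range'_1]; omega)
  simp only [unobstructedFormula, Realize, realize_alls] at hu
  simp only [generatesFormula, Realize, realize_exs, realize_wordTerm, zero_add,
    FirstOrder.Language.Term.realize_var]
  constructor
  · rintro ⟨i, v', hv', h | h⟩ hun
    · exact absurd (hu.2 hun i v' hv') h
    · rw [hx v' hv', hz v' hv'] at h
      exact ⟨_, h⟩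
  · intro h
    by_cases hun : IsUnobstructed R fun i : Fin n => v i
    · obtain ⟨w, hw⟩ := h hun
      -- Only the last component matters here; the rest is filler.
      let D : Obstruction := ((0, []), [], w)
      refine ⟨⟨Encodable.encode D, trivial⟩, v, fun _ _ => rfl, Or.inr ?_⟩
      rw [Denumerable.ofNat_encode]
      exact hw
    · rw [← hu] at hun
      push Not at hun
      obtain ⟨i, v', hv', h'⟩ := hun
      exact ⟨i, v', hv', Or.inl h'⟩

theorem realize_existsFormula (v : ℕ → G) :
    (existsFormula n R).Realize v ↔ ∃ x : Fin n → G, IsUnobstructed R x := by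
  simp only [existsFormula, Realize, realize_exs, realize_unobstructedFormula]
  constructor
  · rintro ⟨-, v', -, h⟩
    exact ⟨_, h⟩
  · rintro ⟨x, hx⟩
    refine ⟨⟨0, trivial⟩, fun k => if h : k < n then x ⟨k, h⟩ else v k, fun k hk => ?_, ?_⟩
    · rw [List.mem_range] at hk
      exact dif_neg hk
    · simpa using hx

theorem realize_universalFormula (v : ℕ → G) : (universalFormula n R).Realize v ↔
    ∀ x : Fin n → G, IsUnobstructed R x → ∀ z, ∃ w, z = evalWord x w := by
  simp only [universalFormula, Realize, realize_alls]
  constructor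
  · intro h x hx z
    let v' : ℕ → G := fun k => if h : k < n then x ⟨k, h⟩ else if k = 2 * n then z else v k
    -- Any nonzero index would do: they all carry `generatesFormula`.
    have h1 := h ⟨1, trivial⟩ v' fun k hk => by
      simp only [one_ne_zero, if_false, List.mem_cons, List.mem_range, not_or] at hk
      simp [v', hk.1, hk.2]
    rw [if_neg one_ne_zero, realize_generatesFormula] at h1
    have h2 : (fun i : Fin n => v' i) = x := funext fun i => by simp [v']
    have h3 : v' (2 * n) = z := by
      have : ¬ 2 * n < n := by omega
      simp [v', this]
    rw [h2, h3] at h1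
    exact h1 hx
  · intro h i v' _
    split_ifs
    · exact realize_groupAxioms v'
    · rw [realize_generatesFormula]
      exact fun hx => h _ hx _

end

theorem isScottSentence_scottSentence {G : Type u} [Group G] {a : Fin n → G}
    (h : IsPresentedBy a R) (hG : IsPolycyclic G) :
    IsScottSentence.{u, v} (scottSentence n R) G := by
  have := wellFoundedGT_subgroup hG.2
  have hsep := hG.subgroupSeparable
  refine ⟨isSentence_scottSentence, fun M S _ => ⟨fun hM => ?_, ?_⟩⟩
  · have hne : Nonempty M := ⟨S.funMap (n := 0) GroupFunc.one ![]⟩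
    -- At this point `M` is a bare structure; the conjunct of index `0` makes it a group, after
    -- which the semantic lemmas apply.
    have hax : ∀ w : ℕ → M, groupAxioms.Realize w := fun w => by
      have h0 := (hM w).2
      simp only [universalFormula, Realize, realize_alls] at h0
      have := h0 ⟨0, trivial⟩ w fun _ _ => rfl
      rwa [if_pos rfl] at this
    obtain ⟨g, rfl⟩ := exists_eq_groupStructure hax
    have h1 := hM fun _ => 1
    obtain ⟨x, hx⟩ := (realize_existsFormula _).1 h1.1
    obtain ⟨e⟩ := hx.nonempty_mulEquiv h hsep ((realize_universalFormula _).1 h1.2 x hx)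
    exact ⟨structureEquiv e.symm⟩
  · rintro ⟨e⟩ v
    rw [realize_equiv e]
    exact ⟨(realize_existsFormula _).2 ⟨a, h.isUnobstructed⟩,
      (realize_universalFormula _).2 fun x hx => hx.exists_evalWord_eq h hsep⟩

end

end ScottGroup

theorem mainTheorem2 (G : Type u) [Group G] (hG : ScottGroup.IsPolycyclic G) :
    ∃ φ : ScottGroup.InfFormula, φ.IsComputable ∧ φ.IsDSigma 2 ∧
      ScottGroup.InfFormula.IsScottSentence.{u, v} φ G := by
  have := hG.isFinitelyPresented
  obtain ⟨n, _, a, R, h⟩ := ScottGroup.exists_isPresentedBy (G := G)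
  exact ⟨ScottGroup.scottSentence n R, ScottGroup.isComputable_scottSentence,
    ScottGroup.isDSigma_scottSentence, ScottGroup.isScottSentence_scottSentence h hG⟩
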